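/- Let $R$ be a coherent ring, i.e. an associative unital ring for which the category $\mathrm{mod}(R)$ of finitely presented right $R$-modules and the category $\mathrm{mod}(R^{op})$ of finitely presented left $R$-modules are both abelian. Let $\mathrm{Mod}(R)$ and $\mathrm{Mod}(R^{op})$ be the categories of all right, respectively left, $R$-modules. For an abelian category $\mathcal A$ let $\mathrm{fp}(\mathcal A,\mathrm{Ab})$ be the category of functors $F:\mathcal A\to\mathrm{Ab}$ that have a presentation $(Y,-)\to(X,-)\to F\to 0$ by representable functors. A functor $F\in\mathrm{fp}(\mathrm{Mod}(R),\mathrm{Ab})$ is totally finitely presented if it has such a presentation with $X,Y\in\mathrm{mod}(R)$. The defect $w$, on $\mathrm{fp}(\mathrm{Mod}(R),\mathrm{Ab})$ with values in $\mathrm{Mod}(R)$ and likewise on $\mathrm{fp}(\mathrm{Mod}(R^{op}),\mathrm{Ab})$ with values in $\mathrm{Mod}(R^{op})$, is the contravariant exact functor with $w(X,-)\cong X$ naturally in $X$; thus $w(F)\cong\ker(f)$ if $(Y,-)\to(X,-)\to F\to 0$ is a presentation induced by $f:X\to Y$. Let $D:\mathrm{fp}(\mathrm{Mod}(R),\mathrm{Ab})\to\mathrm{fp}(\mathrm{Mod}(R^{op}),\mathrm{Ab})$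 be the zeroth left derived functor, computed with injective resolutions, of the contravariant functor $F\mapsto (F(R),-)$, where $F(R)$ is a left $R$-module through left multiplication on the right module $R$. Likewise, for a functor $G$ on left modules, $G(R)$ is a right $R$-module. Then for every totally finitely presented functor $F:\mathrm{Mod}(R)\to\mathrm{Ab}$: 1. $w(D(F))\cong F(R)$ as left $R$-modules; 2. $w(F)\cong D(F)(R)$ as right $R$-modules. In particular, for every finitely presented left $R$-module $X$, the functor $-\otimes_R X:\mathrm{Mod}(R)\to\mathrm{Ab}$ is totally finitely presented and $w(-\otimes_R X)\cong X^*=\mathrm{Hom}_R(X,R)$ as right $R$-modules. -/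

import Mathlib

open CategoryTheory CategoryTheory.Limits Opposite ZeroObject

set_option linter.unusedSectionVars false

universe v u

namespace FunctorDefect

noncomputable section

section General

variable {C : Type u} [Category.{v} C] [Abelian C]

/-- The representable functor `(X, -) : C ⥤ Ab`. -/
abbrev homFunctor (X : C) : C ⥤ AddCommGrpCat.{v} := preadditiveCoyoneda.obj (op X)

/-- The functors `F : C ⥤ Ab` that have a presentation `(Y, -) ⟶ (X, -) ⟶ F ⟶ 0` in which
the objects `X` and `Y` satisfy `P`. -/
def presentedBy (P : ObjectProperty C) : ObjectProperty (C ⥤ AddCommGrpCat.{v}) := fun F =>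
  ∃ (X Y : C) (α : homFunctor Y ⟶ homFunctor X), P X ∧ P Y ∧ Nonempty (F ≅ cokernel α)

/-- Elementwise form of a presentation `(Y, -) ⟶ (X, -) ⟶ F ⟶ 0`: the first map is induced by
`f : X ⟶ Y` and `x ∈ F(X)` is the image of the identity of `X`. -/
structure Pres (F : C ⥤ AddCommGrpCat.{v}) {X Y : C} (f : X ⟶ Y) (x : F.obj X) : Prop where
  additive : F.Additive
  zero : F.map f x = 0
  surj : ∀ (A : C) (a : F.obj A), ∃ g : X ⟶ A, F.map g x = a
  rel : ∀ (A : C) (g : X ⟶ A), F.map g x = 0 → ∃ v : Y ⟶ A, f ≫ v = g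

lemma map_add_apply (F : C ⥤ AddCommGrpCat.{v}) [F.Additive] {X A : C} (a b : X ⟶ A) (x : F.obj X) :
    F.map (a + b) x = F.map a x + F.map b x := by
  rw [F.map_add]; rfl

lemma map_sub_apply (F : C ⥤ AddCommGrpCat.{v}) [F.Additive] {X A : C} (a b : X ⟶ A) (x : F.obj X) :
    F.map (a - b) x = F.map a x - F.map b x := by
  rw [F.map_sub]; rfl

lemma map_zero_apply (F : C ⥤ AddCommGrpCat.{v}) [F.Additive] {X A : C} (x : F.obj X) :
    F.map (0 : X ⟶ A) x = 0 := by
  rw [F.map_zero]; rfl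

lemma map_comp_apply' (F : C ⥤ AddCommGrpCat.{v}) {X A B : C} (a : X ⟶ A) (b : A ⟶ B)
    (x : F.obj X) : F.map (a ≫ b) x = F.map b (F.map a x) := by
  rw [F.map_comp]; rfl

/-- The transformation `(X, -) ⟶ F` that corresponds to an element of `F(X)`. -/
def ofElt (F : C ⥤ AddCommGrpCat.{v}) [F.Additive] {X : C} (x : F.obj X) : homFunctor X ⟶ F where
  app A := AddCommGrpCat.ofHom (AddMonoidHom.mk' (fun g : X ⟶ A => F.map g x)
    (fun a b => map_add_apply F (X := X) (A := A) a b x))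
  naturality A B h := by
    ext (g : X ⟶ A)
    exact map_comp_apply' F g h x

lemma ofElt_app {F : C ⥤ AddCommGrpCat.{v}} [F.Additive] {X : C} (x : F.obj X) {A : C}
    (g : X ⟶ A) : (ofElt F x).app A (show (homFunctor X).obj A from g) = F.map g x := rfl

/-- The element of `F(X)` that corresponds to a transformation `(X, -) ⟶ F`. -/
def elt {F : C ⥤ AddCommGrpCat.{v}} {X : C} (φ : homFunctor X ⟶ F) : F.obj X :=
  φ.app X (show (homFunctor X).obj X from 𝟙 X)

lemma app_eq {F : C ⥤ AddCommGrpCat.{v}} {X : C} (φ : homFunctor X ⟶ F) {A : C} (g : X ⟶ A) :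
    φ.app A (show (homFunctor X).obj A from g) = F.map g (elt φ) := by
  have e : (show (homFunctor X).obj A from g) =
      (homFunctor X).map g (show (homFunctor X).obj X from 𝟙 X) := (Category.id_comp g).symm
  exact (congrArg (φ.app A) e).trans
    (NatTrans.naturality_apply φ g (show (homFunctor X).obj X from 𝟙 X))

lemma hom_ext_elt {F : C ⥤ AddCommGrpCat.{v}} {X : C} {φ ψ : homFunctor X ⟶ F}
    (h : elt φ = elt ψ) : φ = ψ := by
  ext A (g : X ⟶ A)
  exact (app_eq φ g).trans ((congrArg _ h).trans (app_eq ψ g).symm)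

lemma cokernel_surjective {F G : C ⥤ AddCommGrpCat.{v}} (φ : F ⟶ G) (A : C)
    (a : (cokernel φ).obj A) :
    ∃ b, (cokernel.π φ).app A b = a := 
  (AddCommGrpCat.epi_iff_surjective ((cokernel.π φ).app A)).1 inferInstance a

lemma cokernel_zero {F G : C ⥤ AddCommGrpCat.{v}} (φ : F ⟶ G) (A : C) (b : F.obj A) :
    (cokernel.π φ).app A (φ.app A b) = 0 := by
  have := congrArg (fun t => t.app A b) (cokernel.condition φ)
  exact this

lemma cokernel_exact {F G : C ⥤ AddCommGrpCat.{v}} (φ : F ⟶ G) (A : C) (b : G.obj A)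
    (h : (cokernel.π φ).app A b = 0) : ∃ c, φ.app A c = b := by
  have h1 := (ShortComplex.exact_cokernel φ).map ((evaluation C AddCommGrpCat.{v}).obj A)
  exact (ShortComplex.ab_exact_iff _).1 h1 b h

lemma Pres.of_cokernel {X Y : C} (α : homFunctor Y ⟶ homFunctor X) {F : C ⥤ AddCommGrpCat.{v}}
    (e : F ≅ cokernel α) : ∃ (f : X ⟶ Y) (x : F.obj X), Pres F f x := by
  let φ : homFunctor X ⟶ F := cokernel.π α ≫ e.inv
  have hφ : ∀ (A : C) (b : (homFunctor X).obj A), φ.app A b = e.inv.app A ((cokernel.π α).app A b) :=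
    fun _ _ => rfl
  have hinj : ∀ (A : C) (c : (cokernel α).obj A), e.inv.app A c = 0 → c = 0 := by
    intro A c hc
    have : e.hom.app A (e.inv.app A c) = c := by
      have := congrArg (fun t => t.app A c) e.inv_hom_id
      exact this
    rw [← this, hc, map_zero]
  have hsurj : ∀ (A : C) (a : F.obj A), ∃ g : X ⟶ A, F.map g (elt φ) = a := by
    intro A a
    obtain ⟨b, hb⟩ := cokernel_surjective α A (e.hom.app A a)
    refine ⟨b, (app_eq φ (show X ⟶ A from b)).symm.trans ?_⟩
    change φ.app A b = a
    rw [hφ]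
    have : e.inv.app A (e.hom.app A a) = a := by
      have := congrArg (fun t => t.app A a) e.hom_inv_id
      exact this
    rw [← this, ← hb]
  refine ⟨elt α, elt φ, ⟨⟨?_⟩, ?_, hsurj, ?_⟩⟩
  · intro A B a b
    ext t
    obtain ⟨g, rfl⟩ := hsurj A t
    have key : ∀ c : A ⟶ B, F.map c (F.map g (elt φ)) = φ.app B (show (homFunctor X).obj B from g ≫ c) :=
      fun c => by rw [app_eq, map_comp_apply']
    change _ = F.map a _ + F.map b _
    rw [key, key, key, ← map_add]
    exact congrArg (φ.app B) (Preadditive.comp_add _ _ _ g a b)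
  · have := app_eq φ (elt α)
    rw [← this, hφ]
    exact (congrArg _ (cokernel_zero α _ _)).trans (map_zero _)
  · intro A g hg
    rw [← app_eq φ, hφ] at hg
    obtain ⟨c, hc⟩ := cokernel_exact α A _ (hinj _ _ hg)
    exact ⟨c, by rw [← hc]; exact (app_eq α c).symm⟩

lemma Pres.nonempty_iso {F : C ⥤ AddCommGrpCat.{v}} {X Y : C} {f : X ⟶ Y} {x : F.obj X}
    (h : Pres F f x) : Nonempty (F ≅ cokernel (preadditiveCoyoneda.map f.op)) := by
  have := h.additive
  let d : cokernel (preadditiveCoyoneda.map f.op) ⟶ F := cokernel.desc _ (ofElt F x) (by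
    apply hom_ext_elt
    change F.map (f ≫ 𝟙 _) x = 0
    rw [Category.comp_id, h.zero])
  have hd : ∀ (A : C) (g : (homFunctor X).obj A), d.app A ((cokernel.π (preadditiveCoyoneda.map f.op)).app A g) = F.map (show X ⟶ A from g) x := 
    fun A g => by
      have := congrArg (fun t => t.app A g) (cokernel.π_desc (preadditiveCoyoneda.map f.op) (ofElt F x) (by
    apply hom_ext_elt
    change F.map (f ≫ 𝟙 _) x = 0
    rw [Category.comp_id, h.zero]))
      exact this
  have : ∀ A, IsIso (d.app A) := by
    intro A
    have h1 : Mono (d.app A) := by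
      rw [AddCommGrpCat.mono_iff_injective, injective_iff_map_eq_zero]
      intro c hc
      obtain ⟨g, rfl⟩ := cokernel_surjective _ A c
      rw [hd] at hc
      obtain ⟨v, hv⟩ := h.rel A g hc
      rw [← hv]
      exact cokernel_zero (preadditiveCoyoneda.map f.op) A v
    have h2 : Epi (d.app A) := by
      rw [AddCommGrpCat.epi_iff_surjective]
      intro a
      obtain ⟨g, rfl⟩ := h.surj A a
      exact ⟨_, hd A g⟩
    exact isIso_of_mono_of_epi _
  have : IsIso d := NatIso.isIso_of_isIso_app d
  exact ⟨(asIso d).symm⟩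

lemma presentedBy_iff (P : ObjectProperty C) (F : C ⥤ AddCommGrpCat.{v}) :
    presentedBy P F ↔ ∃ (X Y : C) (f : X ⟶ Y) (x : F.obj X), P X ∧ P Y ∧ Pres F f x := by
  constructor
  · rintro ⟨X, Y, α, hX, hY, ⟨e⟩⟩
    obtain ⟨f, x, h⟩ := Pres.of_cokernel α e
    exact ⟨X, Y, f, x, hX, hY, h⟩
  · rintro ⟨X, Y, f, x, hX, hY, h⟩
    exact ⟨X, Y, _, hX, hY, h.nonempty_iso⟩

/-- Maps out of a presented functor. -/
lemma Pres.exists_hom {F : C ⥤ AddCommGrpCat.{v}} {X Y : C} {f : X ⟶ Y} {x : F.obj X}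
    (h : Pres F f x) {H : C ⥤ AddCommGrpCat.{v}} [H.Additive] (y : H.obj X) (hy : H.map f y = 0) :
    ∃ φ : F ⟶ H, φ.app X x = y := by
  have := h.additive
  choose s hs using h.surj
  have key : ∀ (A : C) (g g' : X ⟶ A), F.map g x = F.map g' x → H.map g y = H.map g' y := by
    intro A g g' e
    obtain ⟨v, hv⟩ := h.rel A (g - g') (by rw [map_sub_apply, e, sub_self])
    rw [← sub_eq_zero, ← map_sub_apply, ← hv, map_comp_apply', hy, map_zero]
  refine ⟨{ app := fun A => AddCommGrpCat.ofHom (AddMonoidHom.mk' (fun a => H.map (s A a) y) ?_)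
            naturality := ?_ }, ?_⟩
  · intro a b
    rw [← map_add_apply]
    apply key
    rw [map_add_apply, hs, hs, hs]
  · intro A B g
    ext a
    change H.map (s B (F.map g a)) y = H.map g (H.map (s A a) y)
    rw [← map_comp_apply']
    apply key
    rw [map_comp_apply', hs, hs]
  · change H.map (s X x) y = y
    rw [key X (s X x) (𝟙 X) (by rw [hs]; simp)]
    simp

lemma Pres.hom_ext {F : C ⥤ AddCommGrpCat.{v}} {X Y : C} {f : X ⟶ Y} {x : F.obj X}
    (h : Pres F f x) {H : C ⥤ AddCommGrpCat.{v}} {φ ψ : F ⟶ H} (e : φ.app X x = ψ.app X x) :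
    φ = ψ := by
  ext A a
  obtain ⟨g, rfl⟩ := h.surj A a
  rw [NatTrans.naturality_apply, NatTrans.naturality_apply, e]

/-- The finitely presented functors `C ⥤ Ab`. They are automatically additive. -/
def isFP : ObjectProperty (C ⥤ AddCommGrpCat.{v}) := presentedBy ⊤

lemma isFP_iff (F : C ⥤ AddCommGrpCat.{v}) :
    isFP F ↔ ∃ (X Y : C) (f : X ⟶ Y) (x : F.obj X), Pres F f x := by
  rw [isFP, presentedBy_iff]
  simp

lemma nat_apply {F G : C ⥤ AddCommGrpCat.{v}} (φ : F ⟶ G) {A B : C} (g : A ⟶ B) (a : F.obj A) :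
    φ.app B (F.map g a) = G.map g (φ.app A a) := NatTrans.naturality_apply φ g a

lemma Pres.kernel {K F G : C ⥤ AddCommGrpCat.{v}} {k : K ⟶ F} {φ : F ⟶ G}
    (hk : ∀ (A : C) (a : K.obj A), φ.app A (k.app A a) = 0)
    (hinj : ∀ A, Function.Injective (k.app A))
    (hex : ∀ (A : C) (a : F.obj A), φ.app A a = 0 → ∃ b, k.app A b = a)
    (hF : isFP F) (hG : isFP G) : isFP K := by
  rw [isFP_iff] at hF hG ⊢
  obtain ⟨X, Y, f, x, hF⟩ := hF
  obtain ⟨X', Y', f', x', hG⟩ := hG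
  have := hF.additive
  have := hG.additive
  obtain ⟨h, hh⟩ := hG.surj X (φ.app X x)
  obtain ⟨z, hz⟩ := hex (pushout h f') (F.map (pushout.inl h f') x) (by
    rw [nat_apply, ← hh, ← map_comp_apply', pushout.condition, map_comp_apply', hG.zero, map_zero])
  refine ⟨_, _, pushout.inl (pushout.inl h f') f, z, ⟨⟨?_⟩, ?_, ?_, ?_⟩⟩
  · intro A B a b
    ext t
    apply hinj
    change k.app B (K.map (a + b) t) = k.app B (K.map a t + K.map b t)
    rw [map_add, nat_apply, nat_apply, nat_apply, map_add_apply]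
  · apply hinj
    rw [nat_apply, hz, ← map_comp_apply', pushout.condition, map_comp_apply', hF.zero, map_zero,
      map_zero]
  · intro A a
    obtain ⟨g, hg⟩ := hF.surj A (k.app A a)
    obtain ⟨w, hw⟩ := hG.rel A (h ≫ g) (by
      rw [map_comp_apply', hh, ← nat_apply, hg, hk])
    refine ⟨pushout.desc g w hw.symm, hinj _ ?_⟩
    rw [nat_apply, hz, ← map_comp_apply', pushout.inl_desc, hg]
  · intro A g hg
    obtain ⟨w, hw⟩ := hF.rel A (pushout.inl h f' ≫ g) (by
      rw [map_comp_apply', ← hz, ← nat_apply, hg, map_zero])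
    exact ⟨pushout.desc g w hw.symm, pushout.inl_desc _ _ _⟩

lemma Pres.cokernel {F G Q : C ⥤ AddCommGrpCat.{v}} {φ : F ⟶ G} {q : G ⟶ Q}
    (hq : ∀ (A : C) (a : F.obj A), q.app A (φ.app A a) = 0)
    (hsurj : ∀ A, Function.Surjective (q.app A))
    (hex : ∀ (A : C) (a : G.obj A), q.app A a = 0 → ∃ b, φ.app A b = a)
    (hF : isFP F) (hG : isFP G) : isFP Q := by
  rw [isFP_iff] at hF hG ⊢
  obtain ⟨X, Y, f, x, hF⟩ := hF
  obtain ⟨X', Y', f', x', hG⟩ := hG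
  have := hF.additive
  have := hG.additive
  obtain ⟨h, hh⟩ := hG.surj X (φ.app X x)
  refine ⟨X', X ⊞ Y', biprod.lift h f', q.app X' x', ⟨⟨?_⟩, ?_, ?_, ?_⟩⟩
  · intro A B a b
    ext t
    obtain ⟨t, rfl⟩ := hsurj A t
    change Q.map (a + b) _ = Q.map a _ + Q.map b _
    rw [← nat_apply, ← nat_apply, ← nat_apply, map_add_apply, map_add]
  · rw [biprod.lift_eq, ← nat_apply, map_add_apply, map_comp_apply', map_comp_apply', hG.zero,
      map_zero, add_zero, hh, ← nat_apply, hq]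
  · intro A a
    obtain ⟨a, rfl⟩ := hsurj A a
    obtain ⟨g, rfl⟩ := hG.surj A a
    exact ⟨g, by rw [nat_apply]⟩
  · intro A g hg
    obtain ⟨a, ha⟩ := hex A (G.map g x') (by rw [nat_apply, hg])
    obtain ⟨c, rfl⟩ := hF.surj A a
    obtain ⟨w, hw⟩ := hG.rel A (g - h ≫ c) (by
      rw [map_sub_apply, map_comp_apply', hh, ← nat_apply, ha, sub_self])
    exact ⟨biprod.desc c w, by rw [biprod.lift_desc, hw]; abel⟩

lemma Pres.biprod {F G B : C ⥤ AddCommGrpCat.{v}} {i : F ⟶ B} {j : G ⟶ B} {p : B ⟶ F} {q : B ⟶ G}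
    (hip : i ≫ p = 𝟙 F) (hjq : j ≫ q = 𝟙 G) (hiq : i ≫ q = 0) (hjp : j ≫ p = 0)
    (htot : p ≫ i + q ≫ j = 𝟙 B) (hF : isFP F) (hG : isFP G) : isFP B := by
  rw [isFP_iff] at hF hG ⊢
  obtain ⟨X, Y, f, x, hF⟩ := hF
  obtain ⟨X', Y', f', x', hG⟩ := hG
  have := hF.additive
  have := hG.additive
  have hip' : ∀ (A : C) (a : F.obj A), p.app A (i.app A a) = a := fun A a =>
    congrArg (fun t => t.app A a) hip
  have hjq' : ∀ (A : C) (a : G.obj A), q.app A (j.app A a) = a := fun A a =>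
    congrArg (fun t => t.app A a) hjq
  have hiq' : ∀ (A : C) (a : F.obj A), q.app A (i.app A a) = 0 := fun A a =>
    congrArg (fun t => t.app A a) hiq
  have hjp' : ∀ (A : C) (a : G.obj A), p.app A (j.app A a) = 0 := fun A a =>
    congrArg (fun t => t.app A a) hjp
  have htot' : ∀ (A : C) (a : B.obj A), i.app A (p.app A a) + j.app A (q.app A a) = a := fun A a =>
    congrArg (fun t => t.app A a) htot
  have hext : ∀ (A : C) (a b : B.obj A), p.app A a = p.app A b → q.app A a = q.app A b → a = b := by
    intro A a b h1 h2
    rw [← htot' A a, ← htot' A b, h1, h2]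
  let b : B.obj (X ⊞ X') := i.app _ (F.map biprod.inl x) + j.app _ (G.map biprod.inr x')
  have hpb : ∀ (A : C) (g : X ⊞ X' ⟶ A), p.app A (B.map g b) = F.map (biprod.inl ≫ g) x := by
    intro A g
    rw [nat_apply, map_add, hip', hjp', add_zero, map_comp_apply']
  have hqb : ∀ (A : C) (g : X ⊞ X' ⟶ A), q.app A (B.map g b) = G.map (biprod.inr ≫ g) x' := by
    intro A g
    rw [nat_apply, map_add, hiq', hjq', zero_add, map_comp_apply']
  refine ⟨X ⊞ X', Y ⊞ Y', biprod.map f f', b, ⟨⟨?_⟩, ?_, ?_, ?_⟩⟩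
  · intro A A' a b
    ext t
    change B.map (a + b) t = B.map a t + B.map b t
    apply hext
    · rw [map_add, nat_apply, nat_apply, nat_apply, map_add_apply]
    · rw [map_add, nat_apply, nat_apply, nat_apply, map_add_apply]
  · apply hext
    · rw [hpb, biprod.inl_map, map_comp_apply', hF.zero, map_zero, map_zero]
    · rw [hqb, biprod.inr_map, map_comp_apply', hG.zero, map_zero, map_zero]
  · intro A a
    obtain ⟨g, hg⟩ := hF.surj A (p.app A a)
    obtain ⟨g', hg'⟩ := hG.surj A (q.app A a)
    refine ⟨biprod.desc g g', hext _ _ _ ?_ ?_⟩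
    · rw [hpb, biprod.inl_desc, hg]
    · rw [hqb, biprod.inr_desc, hg']
  · intro A g hg
    obtain ⟨w, hw⟩ := hF.rel A (biprod.inl ≫ g) (by rw [← hpb, hg, map_zero])
    obtain ⟨w', hw'⟩ := hG.rel A (biprod.inr ≫ g) (by rw [← hqb, hg, map_zero])
    refine ⟨biprod.desc w w', ?_⟩
    ext
    · simp [hw]
    · simp [hw']

instance : (isFP (C := C)).IsClosedUnderIsomorphisms where
  of_iso {F G} e := by
    rintro ⟨X, Y, α, hX, hY, ⟨e'⟩⟩
    exact ⟨X, Y, α, hX, hY, ⟨e.symm ≪≫ e'⟩⟩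

lemma isFP_of_isZero {F : C ⥤ AddCommGrpCat.{v}} (hF : IsZero F) : isFP F := by
  rw [isFP_iff]
  have h0 : ∀ (A : C) (a : F.obj A), a = 0 := fun A a =>
    congrArg (fun t => t.app A a) (hF.eq_of_src (𝟙 F) 0)
  refine ⟨0, 0, 0, 0, ⟨⟨?_⟩, h0 _ _, fun A a => ⟨0, (h0 A _).trans (h0 A _).symm⟩,
    fun A g _ => ⟨0, by ext⟩⟩⟩
  intro A B a b
  ext t
  exact (h0 _ _).trans (h0 _ _).symm

instance : (isFP (C := C)).ContainsZero where
  exists_zero := ⟨_, isZero_zero _, isFP_of_isZero (isZero_zero _)⟩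

instance : (isFP (C := C)).IsClosedUnderKernels where
  kernels_le := by
    rintro K ⟨φ, k, hk, hφ⟩
    have : Mono k.ι := Fork.IsLimit.mono hk
    let S : ShortComplex (C ⥤ AddCommGrpCat.{v}) := ShortComplex.mk k.ι φ k.condition
    have hS : S.Exact := S.exact_of_f_is_kernel
      (IsLimit.ofIsoLimit hk (Fork.ext (Iso.refl _) (by simp [S])))
    refine Pres.kernel (k := k.ι) (φ := φ) (fun A a => ?_) (fun A => ?_) (fun A a ha => ?_) hφ.1 hφ.2
    · exact congrArg (fun t => t.app A a) k.condition
    · exact (AddCommGrpCat.mono_iff_injective (k.ι.app A)).1 inferInstance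
    · exact (ShortComplex.ab_exact_iff _).1
        (hS.map ((evaluation C AddCommGrpCat.{v}).obj A)) a ha

instance : (isFP (C := C)).IsClosedUnderCokernels where
  cokernels_le := by
    rintro K ⟨φ, k, hk, hφ⟩
    have : Epi k.π := Cofork.IsColimit.epi hk
    let S : ShortComplex (C ⥤ AddCommGrpCat.{v}) := ShortComplex.mk φ k.π k.condition
    have hS : S.Exact := S.exact_of_g_is_cokernel
      (IsColimit.ofIsoColimit hk (Cofork.ext (Iso.refl _) (by simp [S])))
    refine Pres.cokernel (φ := φ) (q := k.π) (fun A a => ?_) (fun A => ?_) (fun A a ha => ?_) hφ.1 hφ.2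
    · exact congrArg (fun t => t.app A a) k.condition
    · exact (AddCommGrpCat.epi_iff_surjective (k.π.app A)).1 inferInstance
    · exact (ShortComplex.ab_exact_iff _).1
        (hS.map ((evaluation C AddCommGrpCat.{v}).obj A)) a ha

instance : (isFP (C := C)).IsClosedUnderBinaryProducts where
  limitsOfShape_le := by
    rintro B ⟨p⟩
    refine isFP.prop_of_iso (?_ : p.diag.obj ⟨.left⟩ ⊞ p.diag.obj ⟨.right⟩ ≅ B)
      (Pres.biprod biprod.inl_fst biprod.inr_snd biprod.inl_snd biprod.inr_fst biprod.total
        (p.prop_diag_obj ⟨.left⟩) (p.prop_diag_obj ⟨.right⟩))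
    exact IsLimit.conePointUniqueUpToIso (BinaryBiproduct.isLimit _ _)
      ((IsLimit.postcomposeHomEquiv (diagramIsoPair p.diag) _).2 p.isLimit)

instance : (isFP (C := C)).IsClosedUnderFiniteProducts := .mk'

variable (C) in
/-- The category `fp(C, Ab)` of finitely presented functors and natural transformations. -/
abbrev FP := (isFP (C := C)).FullSubcategory

instance : Abelian (FP C) := inferInstance

lemma Pres.homFunctor (X : C) :
    Pres (homFunctor X) (0 : X ⟶ 0) (show (homFunctor X).obj X from 𝟙 X) where
  additive := inferInstance
  zero := comp_zero (C := C)
  surj A a := ⟨a, Category.id_comp (show X ⟶ A from a)⟩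
  rel A g hg := ⟨0, by rw [comp_zero]; exact hg.symm.trans (Category.id_comp g)⟩

lemma isFP_homFunctor (X : C) : isFP (homFunctor X) :=
  (isFP_iff _).2 ⟨_, _, _, _, Pres.homFunctor X⟩

variable (C) in
/-- The Yoneda embedding `X ↦ (X, -)`, a contravariant functor from `C` to `fp(C, Ab)`. -/
def yonedaFP : Cᵒᵖ ⥤ FP C :=
  isFP.lift preadditiveCoyoneda fun X => isFP_homFunctor X.unop

instance (F : FP C) : F.obj.Additive :=
  let ⟨_, _, _, _, h⟩ := (isFP_iff _).1 F.property
  h.additive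

/-- Monomorphisms of `fp(C, Ab)` are pointwise injective. -/
lemma injective_of_mono {F G : FP C} (m : F ⟶ G) [Mono m] (A : C) :
    Function.Injective (m.hom.app A) := by
  have : Mono m.hom := by
    have := (isFP (C := C)).preservesMonomorphisms_ι_of_isNormalEpiCategory
    exact inferInstanceAs (Mono ((isFP (C := C)).ι.map m))
  exact (AddCommGrpCat.mono_iff_injective (m.hom.app A)).1 inferInstance

/-- A quotient of a map between representables at projectives is injective in `fp(C, Ab)`. -/
lemma Pres.injective {I : FP C} {P Q : C} [Projective P] [Projective Q] {d : P ⟶ Q}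
    {t : I.obj.obj P} (hI : Pres I.obj d t) : Injective I where
  factors {F G} a m _ := by
    have hm := injective_of_mono m
    obtain ⟨X, Y, f, x, hF⟩ := (isFP_iff _).1 F.property
    obtain ⟨X', Y', f', x', hG⟩ := (isFP_iff _).1 G.property
    obtain ⟨h, hh⟩ := hG.surj X (m.hom.app X x)
    -- the element `F(X ⟶ Z)(x)` vanishes, where `Z` is the pushout
    have h0 : F.obj.map (pushout.inl h f') x = 0 := by
      apply hm
      rw [nat_apply, ← hh, ← map_comp_apply', pushout.condition, map_comp_apply', hG.zero,
        map_zero, map_zero]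
    let y := a.hom.app X x
    have hy : I.obj.map (pushout.inl h f') y = 0 := by
      rw [← nat_apply, h0, map_zero]
    obtain ⟨g, hg⟩ := hI.surj X y
    obtain ⟨u, hu⟩ := hI.rel _ (g ≫ pushout.inl h f') (by rw [map_comp_apply', hg, hy])
    -- the exact sequence `X' ⟶ X ⊞ Y' ⟶ Z ⟶ 0`
    have hZ := IsPushout.of_hasPushout h f'
    have hS := hZ.exact_shortComplex
    have : Epi (biprod.desc (pushout.inl h f') (pushout.inr h f')) := hZ.epi_shortComplex_g
    let u' := Projective.factorThru u (biprod.desc (pushout.inl h f') (pushout.inr h f'))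
    have hu' : u' ≫ biprod.desc (pushout.inl h f') (pushout.inr h f') = u :=
      Projective.factorThru_comp _ _
    have hr0 : (g ≫ biprod.inl - d ≫ u') ≫ biprod.desc (pushout.inl h f') (pushout.inr h f') = 0 := by
      rw [Preadditive.sub_comp, Category.assoc, Category.assoc, hu', biprod.inl_desc, hu, sub_self]
    let r : P ⟶ X' := hS.liftFromProjective (g ≫ biprod.inl - d ≫ u') hr0
    have hr : r ≫ biprod.lift h (-f') = g ≫ biprod.inl - d ≫ u' :=
      hS.liftFromProjective_comp _ hr0
    have hr1 : r ≫ h = g - d ≫ u' ≫ biprod.fst := by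
      simpa using congrArg (· ≫ biprod.fst) hr
    have hr2 : r ≫ f' = d ≫ u' ≫ biprod.snd := by
      simpa using congrArg (· ≫ biprod.snd) hr
    obtain ⟨φ, hφ⟩ := hG.exists_hom (H := I.obj) (I.obj.map r t) (by
      rw [← map_comp_apply', hr2, map_comp_apply', hI.zero, map_zero])
    refine ⟨ObjectProperty.homMk φ, ?_⟩
    ext : 1
    apply hF.hom_ext
    change φ.app X (m.hom.app X x) = a.hom.app X x
    rw [← hh, nat_apply, hφ, ← map_comp_apply', hr1, map_sub_apply, hg, map_comp_apply', hI.zero,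
      map_zero, sub_zero]

lemma mono_of_injective {F G : FP C} (m : F ⟶ G)
    (h : ∀ (A : C) (a : F.obj.obj A), m.hom.app A a = 0 → a = 0) : Mono m := by
  have : ∀ A, Mono (m.hom.app A) := fun A => by
    rw [AddCommGrpCat.mono_iff_injective, injective_iff_map_eq_zero]
    exact h A
  have : Mono m.hom := NatTrans.mono_of_mono_app _
  exact (isFP (C := C)).ι.mono_of_mono_map this

/-- The functor `coker ((Q, -) ⟶ (P, -))` induced by `d : P ⟶ Q`. -/
def cokerFP {P Q : C} (d : P ⟶ Q) : FP C :=
  ⟨cokernel (preadditiveCoyoneda.map d.op), ⟨P, Q, _, trivial, trivial, ⟨Iso.refl _⟩⟩⟩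

lemma exists_pres_cokerFP {P Q : C} (d : P ⟶ Q) :
    ∃ t : (cokerFP d).obj.obj P, Pres (cokerFP d).obj d t := by
  let π : homFunctor P ⟶ (cokerFP d).obj := cokernel.π (preadditiveCoyoneda.map d.op)
  refine ⟨elt π, inferInstance, ?_, fun A a => ?_, fun A g hg => ?_⟩
  · rw [← app_eq]
    have := cokernel_zero (preadditiveCoyoneda.map d.op) Q (show (homFunctor Q).obj Q from 𝟙 Q)
    exact (congrArg (π.app Q) (Category.comp_id d).symm).trans this
  · obtain ⟨b, hb⟩ := cokernel_surjective (preadditiveCoyoneda.map d.op) A a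
    exact ⟨b, (app_eq π _).symm.trans hb⟩
  · rw [← app_eq] at hg
    exact cokernel_exact (preadditiveCoyoneda.map d.op) A _ hg

instance [EnoughProjectives C] : EnoughInjectives (FP C) where
  presentation F := by
    obtain ⟨X, Y, f, x, hF⟩ := (isFP_iff _).1 F.property
    let p := Projective.π X
    let q := Projective.π Y
    let d := Projective.factorThru (p ≫ f) q
    have hd : d ≫ q = p ≫ f := Projective.factorThru_comp _ _
    let k := Projective.π (kernel q) ≫ kernel.ι q
    have hk : ∀ {A : C} (u : Projective.over Y ⟶ A), k ≫ u = 0 → ∃ v, q ≫ v = u := by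
      intro A u hu
      have : kernel.ι q ≫ u = 0 := by
        rw [← cancel_epi (Projective.π (kernel q))]
        simpa [k] using hu
      exact ⟨Abelian.epiDesc q u this, Abelian.comp_epiDesc _ _ _⟩
    have hkq : k ≫ q = 0 := by simp [k]
    obtain ⟨t, ht⟩ := exists_pres_cokerFP (biprod.desc d k)
    let I := cokerFP (biprod.desc d k)
    have hI : Injective I := ht.injective
    obtain ⟨φ, hφ⟩ := hF.exists_hom (H := I.obj) (I.obj.map (biprod.desc p 0) t) (by
      have : biprod.desc p 0 ≫ f = biprod.desc d k ≫ q := by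
        ext <;> simp [hd, hkq]
      rw [← map_comp_apply', this, map_comp_apply', ht.zero, map_zero])
    have : Mono (ObjectProperty.homMk φ : F ⟶ I) := by
      apply mono_of_injective
      intro A a ha
      obtain ⟨g, rfl⟩ := hF.surj A a
      change φ.app A (F.obj.map g x) = 0 at ha
      rw [nat_apply, hφ, ← map_comp_apply'] at ha
      obtain ⟨u, hu⟩ := ht.rel _ _ ha
      have hu1 : d ≫ u = p ≫ g := by simpa using congrArg (biprod.inl ≫ ·) hu
      have hu2 : k ≫ u = 0 := by simpa using congrArg (biprod.inr ≫ ·) hu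
      obtain ⟨v, rfl⟩ := hk u hu2
      have : f ≫ v = g := by
        rw [← cancel_epi p, ← hu1, ← Category.assoc, ← hd, Category.assoc]
      rw [← this, map_comp_apply', hF.zero, map_zero]
    exact ⟨⟨I, hI, ObjectProperty.homMk φ, this⟩⟩


lemma exists_pres (F : FP C) : ∃ (X Y : C) (f : X ⟶ Y) (x : F.obj.obj X), Pres F.obj f x :=
  (isFP_iff _).1 F.property

/-! A chosen presentation `(Y, -) ⟶ (X, -) ⟶ F ⟶ 0` of a finitely presented functor: its objects
`X` and `Y`, the morphism `f : X ⟶ Y`, and the image in `F(X)` of the identity of `X`. -/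

def presSrc (F : FP C) : C := (exists_pres F).choose

def presTgt (F : FP C) : C := (exists_pres F).choose_spec.choose

def presMap (F : FP C) : presSrc F ⟶ presTgt F := (exists_pres F).choose_spec.choose_spec.choose

def presElt (F : FP C) : F.obj.obj (presSrc F) :=
  (exists_pres F).choose_spec.choose_spec.choose_spec.choose

lemma presElt_spec (F : FP C) : Pres F.obj (presMap F) (presElt F) :=
  (exists_pres F).choose_spec.choose_spec.choose_spec.choose_spec

/-- A map `F ⟶ (M, -)` is determined by the image of the generator of `F`. -/
def homElt {F : FP C} {M : Cᵒᵖ} (φ : F ⟶ (yonedaFP C).obj M) : M.unop ⟶ presSrc F :=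
  φ.hom.app (presSrc F) (presElt F)

lemma homElt_comp {F : FP C} {M : Cᵒᵖ} (φ : F ⟶ (yonedaFP C).obj M) :
    homElt φ ≫ presMap F = 0 := by
  have h := nat_apply φ.hom (presMap F) (presElt F)
  rw [(presElt_spec F).zero, map_zero] at h
  exact h.symm

/-- The bijection `Nat (F, (M, -)) ≃ Hom (M, ker f)`. -/
def defectEquiv (F : FP C) (M : Cᵒᵖ) :
    (F ⟶ (yonedaFP C).obj M) ≃ (op (kernel (presMap F)) ⟶ M) :=
  Equiv.ofBijective (fun φ => (kernel.lift (presMap F) (homElt φ) (homElt_comp φ)).op)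
    ⟨fun φ ψ h => by
      ext : 1
      apply (presElt_spec F).hom_ext
      have h' := congrArg (fun t => t.unop ≫ kernel.ι (presMap F)) h
      change homElt φ = homElt ψ
      simpa using h',
    fun g => by
      obtain ⟨φ, hφ⟩ := (presElt_spec F).exists_hom (H := homFunctor M.unop)
        (show (homFunctor M.unop).obj (presSrc F) from g.unop ≫ kernel.ι (presMap F)) (by
          change (g.unop ≫ kernel.ι (presMap F)) ≫ presMap F = 0
          simp)
      refine ⟨ObjectProperty.homMk φ, ?_⟩
      apply Quiver.Hom.unop_inj
      rw [← cancel_mono (kernel.ι (presMap F))]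
      exact (kernel.lift_ι _ _ _).trans hφ⟩

lemma defectEquiv_apply (F : FP C) (M : Cᵒᵖ) (φ : F ⟶ (yonedaFP C).obj M) :
    (defectEquiv F M φ).unop ≫ kernel.ι (presMap F) = homElt φ :=
  kernel.lift_ι _ _ (homElt_comp φ)

lemma defectEquiv_naturality (F : FP C) (M M' : Cᵒᵖ) (g : M ⟶ M')
    (h : op (kernel (presMap F)) ⟶ M) :
    (defectEquiv F M').symm (h ≫ g) = (defectEquiv F M).symm h ≫ (yonedaFP C).map g := by
  rw [Equiv.symm_apply_eq]
  obtain ⟨φ, rfl⟩ := (defectEquiv F M).surjective h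
  rw [Equiv.symm_apply_apply]
  apply Quiver.Hom.unop_inj
  rw [← cancel_mono (kernel.ι (presMap F)), defectEquiv_apply, unop_comp, Category.assoc,
    defectEquiv_apply]
  rfl

variable (C) in
/-- The defect as a functor `fp(C, Ab) ⥤ Cᵒᵖ`. On objects it is the kernel of `f : X ⟶ Y`, where
`(Y, -) ⟶ (X, -) ⟶ F ⟶ 0` is the chosen presentation; on morphisms it is determined by the natural
bijection `Nat (F, (M, -)) ≃ Hom (M, ker f)`. -/
def defectOp : FP C ⥤ Cᵒᵖ :=
  Adjunction.leftAdjointOfEquiv (G := yonedaFP C) (fun F M => (defectEquiv F M).symm)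
    defectEquiv_naturality

variable (C) in
/-- The defect is left adjoint to the Yoneda embedding. -/
def defectAdjunction : defectOp C ⊣ yonedaFP C := Adjunction.adjunctionOfEquivLeft _ _

variable (C) in
/-- The defect `w`, a contravariant functor from `fp(C, Ab)` to `C`. -/
def defect : (FP C)ᵒᵖ ⥤ C := (defectOp C).leftOp

instance : (yonedaFP C).Full := inferInstanceAs (isFP.lift _ _).Full
instance : (yonedaFP C).Faithful := inferInstanceAs (isFP.lift _ _).Faithful
instance : (yonedaFP C).Additive where
  map_add {X Y f g} := by
    ext A (t : X.unop ⟶ A)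
    exact Preadditive.add_comp _ _ _ f.unop g.unop t

variable (C) in
/-- The natural isomorphism `w (X, -) ≅ X`. -/
def defectYonedaIso : (yonedaFP C) ⋙ (defectOp C) ≅ 𝟭 Cᵒᵖ := asIso (defectAdjunction C).counit


lemma homFunctor_injective (P : C) [Projective P] : Injective ((yonedaFP C).obj (op P)) := by
  have : Projective (0 : C) := (isZero_zero C).projective
  exact (Pres.homFunctor P).injective

/-- The defect is exact. Together with `w (X, -) ≅ X` this characterizes it. -/
lemma defectOp_exact [EnoughProjectives C] :
    PreservesFiniteLimits (defectOp C) ∧ PreservesFiniteColimits (defectOp C) := by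
  have : PreservesColimits (defectOp C) := (defectAdjunction C).leftAdjoint_preservesColimits
  have : (defectOp C).Additive := (defectAdjunction C).left_adjoint_additive
  have hmono : ∀ {F G : FP C} (m : F ⟶ G) [Mono m], Mono ((defectOp C).map m) := by
    intro F G m _
    let p := Projective.π ((defectOp C).obj F).unop
    have := homFunctor_injective (Projective.over ((defectOp C).obj F).unop)
    let a : F ⟶ (yonedaFP C).obj (op _) := (defectAdjunction C).homEquiv _ _ p.op
    have ha : (defectOp C).map m ≫ ((defectAdjunction C).homEquiv _ _).symm
        (Injective.factorThru a m) = p.op := by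
      rw [← Adjunction.homEquiv_naturality_left_symm, Injective.comp_factorThru]
      simp [a]
    have : Mono ((defectOp C).map m ≫ ((defectAdjunction C).homEquiv _ _).symm
        (Injective.factorThru a m)) := by
      rw [ha]; infer_instance
    exact mono_of_mono _ (((defectAdjunction C).homEquiv _ _).symm (Injective.factorThru a m))
  refine ((defectOp C).exact_tfae.out 0 3).1 fun S hS => ?_
  have key : (∀ S : ShortComplex (FP C), S.ShortExact →
      (S.map (defectOp C)).Exact ∧ Epi ((defectOp C).map S.g)) ↔
      PreservesFiniteColimits (defectOp C) :=
    (defectOp C).preservesFiniteColimits_tfae.out 0 3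
  have h := key.2 inferInstance S hS
  have := hS.mono_f
  have := hmono S.f
  exact { exact := h.1, mono_f := this, epi_g := h.2 }
end General

section Modules

/-- Right multiplications, as endomorphisms of the left `A`-module `A`. -/
def rightMul (A : Type u) [Ring A] : Aᵐᵒᵖ →+* End (ModuleCat.of A A) where
  toFun a := ModuleCat.ofHom (LinearMap.toSpanSingleton A A a.unop)
  map_one' := by
    apply ModuleCat.hom_ext
    ext
    exact one_mul _
  map_mul' a b := by
    apply ModuleCat.hom_ext
    ext
    exact (mul_assoc _ _ _).symm
  map_zero' := by
    apply ModuleCat.hom_ext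
    ext
    exact mul_zero _
  map_add' a b := by
    apply ModuleCat.hom_ext
    ext
    exact mul_add _ _ _

lemma rightMul_apply (A : Type u) [Ring A] (a b : A) : (rightMul A (.op a)).hom b = b * a := rfl

/-! Modules here are left modules, so that `ModuleCat R` is `Mod(R^op)` and `ModuleCat Rᵐᵒᵖ` is the
category `Mod(R)` of right `R`-modules. The functors below go from functors on `A`-modules to
`B`-modules, or to functors on `B`-modules, where `B` is identified with the opposite ring of `A`;
this covers both sides of a ring `R` (`A = Rᵐᵒᵖ`, `B = R` and `A = R`, `B = Rᵐᵒᵖ`). -/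

variable {A B : Type u} [Ring A] [Ring B] (e : B ≃+* Aᵐᵒᵖ)

/-- The action of `B = Aᵐᵒᵖ` on `F(A)` that is induced by right multiplication on `A`. -/
def actionOn (F : FP (ModuleCat.{u} A)) : B →+* End (F.obj.obj (ModuleCat.of A A)) :=
  { toFun := fun b => F.obj.map (rightMul A (e b))
    map_one' := by
      rw [map_one, map_one]
      exact F.obj.map_id _
    map_mul' := fun a b => by
      rw [map_mul, map_mul]
      exact F.obj.map_comp _ _
    map_zero' := by
      rw [map_zero, map_zero]
      exact F.obj.map_zero _ _
    map_add' := fun a b => by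
      rw [map_add, map_add]
      exact F.obj.map_add }

/-- Evaluation at the ring, `F ↦ F(A)`. -/
def evalRing : FP (ModuleCat.{u} A) ⥤ ModuleCat.{u} B where
  obj F := ModuleCat.mkOfSMul (actionOn e F)
  map {F G} φ := ModuleCat.ofHom
    { toFun := fun x => φ.hom.app (ModuleCat.of A A) x
      map_add' := fun x y => map_add (φ.hom.app (ModuleCat.of A A)).hom x y
      map_smul' := fun b x => nat_apply φ.hom (rightMul A (e b)) x }

lemma evalRing_smul (F : FP (ModuleCat.{u} A)) (b : B) (x : (evalRing e).obj F) :
    b • x = F.obj.map (ModuleCat.ofHom (LinearMap.toSpanSingleton A A (e b).unop)) x := rfl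

instance : (evalRing e).Additive where
  map_add := rfl

/-- The contravariant functor `F ↦ (F(A), -)`. -/
def evalYoneda : (FP (ModuleCat.{u} A))ᵒᵖ ⥤ FP (ModuleCat.{u} B) :=
  (evalRing e).op ⋙ yonedaFP (ModuleCat.{u} B)

instance : (evalYoneda e).Additive := inferInstanceAs (_ ⋙ _).Additive

/-- The contravariant functor `D`: the zeroth left derived functor of `F ↦ (F(A), -)`, computed
with injective resolutions in `fp(Mod(A), Ab)`, i.e. projective ones in the opposite category. -/
def duality : (FP (ModuleCat.{u} A))ᵒᵖ ⥤ FP (ModuleCat.{u} B) := (evalYoneda e).leftDerived 0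

variable (R : Type u) [Ring R]

/-- The finitely presented `R`-modules. -/
def isFinPres : ObjectProperty (ModuleCat.{u} R) := fun M => Module.FinitePresentation R M

/-- The totally finitely presented functors. -/
def isTFP : ObjectProperty (ModuleCat.{u} R ⥤ AddCommGrpCat.{u}) := presentedBy (isFinPres R)

variable {R} in
lemma isFP_of_isTFP {F : ModuleCat.{u} R ⥤ AddCommGrpCat.{u}} (h : isTFP R F) : isFP F := by
  obtain ⟨X, Y, α, _, _, e⟩ := h
  exact ⟨X, Y, α, trivial, trivial, e⟩

/-- A ring is coherent if finitely presented left modules and finitely presented right modules both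
form an abelian category. -/
structure IsCoherent : Prop where
  left : Nonempty (Abelian (isFinPres R).FullSubcategory)
  right : Nonempty (Abelian (isFinPres Rᵐᵒᵖ).FullSubcategory)

end Modules

section Tensor

variable {R : Type u} [Ring R]
open TensorProduct

/-- The subgroup of `M ⊗_ℤ X` generated by the elements `(m r) ⊗ x - m ⊗ (r x)`. -/
def balancedRel (M : ModuleCat.{u} Rᵐᵒᵖ) (X : ModuleCat.{u} R) : AddSubgroup (M ⊗[ℤ] X) :=
  AddSubgroup.closure
    {t | ∃ (m : M) (r : R) (x : X), t = (MulOpposite.op r • m) ⊗ₜ[ℤ] x - m ⊗ₜ[ℤ] (r • x)}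

/-- The map `g ⊗ X` on tensor products over `ℤ`. -/
def rTensorInt {M N : ModuleCat.{u} Rᵐᵒᵖ} (X : ModuleCat.{u} R) (g : M ⟶ N) :
    M ⊗[ℤ] X →+ N ⊗[ℤ] X :=
  (g.hom.toAddMonoidHom.toIntLinearMap.rTensor X).toAddMonoidHom

lemma balancedRel_le {M N : ModuleCat.{u} Rᵐᵒᵖ} (X : ModuleCat.{u} R) (g : M ⟶ N) :
    balancedRel M X ≤ (balancedRel N X).comap (rTensorInt X g) := by
  rw [balancedRel, AddSubgroup.closure_le]
  rintro _ ⟨m, r, x, rfl⟩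
  refine AddSubgroup.subset_closure ⟨g.hom m, r, x, ?_⟩
  rw [map_sub]
  exact congrArg (fun t => t ⊗ₜ[ℤ] x - g.hom m ⊗ₜ[ℤ] (r • x)) (g.hom.map_smul _ m)

/-- The functor `- ⊗_R X` on right `R`-modules, for a left `R`-module `X`. -/
def tensorFunctor (X : ModuleCat.{u} R) : ModuleCat.{u} Rᵐᵒᵖ ⥤ AddCommGrpCat.{u} where
  obj M := AddCommGrpCat.of ((M ⊗[ℤ] X) ⧸ balancedRel M X)
  map {M N} g := AddCommGrpCat.ofHom (QuotientAddGroup.map (balancedRel M X) (balancedRel N X)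
    (rTensorInt X g) (balancedRel_le X g))
  map_id M := by
    ext t
    exact congrArg (QuotientAddGroup.mk (s := balancedRel M X))
      (LinearMap.congr_fun (LinearMap.rTensor_id X M) t)
  map_comp {L M N} f g := by
    ext t
    exact congrArg (QuotientAddGroup.mk (s := balancedRel N X)) (LinearMap.congr_fun
      (LinearMap.rTensor_comp X g.hom.toAddMonoidHom.toIntLinearMap
        f.hom.toAddMonoidHom.toIntLinearMap) t)

/-- The dual `X^* = Hom_R(X, R)` of a left `R`-module, a right `R`-module. -/
abbrev dualModule (X : ModuleCat.{u} R) : ModuleCat.{u} Rᵐᵒᵖ := ModuleCat.of Rᵐᵒᵖ (X →ₗ[R] R)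

lemma dualModule_smul (X : ModuleCat.{u} R) (f : X →ₗ[R] R) (r : R) (x : X) :
    (MulOpposite.op r • f) x = f x * r := rfl

end Tensor

end

end FunctorDefect

open FunctorDefect

namespace FunctorDefect

noncomputable section

/-! ### Zeroth left derived functors from a single projective presentation. -/

section Derived

variable {C : Type*} [Category* C] [Abelian C] [EnoughProjectives C]

/-! Choose an injective copresentation `0 ⟶ F ⟶ I ⟶ J` in `fp(Mod(R), Ab)`. As a zeroth derived
functor, `D(F)` is the cokernel of `(J(R), -) ⟶ (I(R), -)`, so it is presented by `I(R) ⟶ J(R)`. Its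
defect is the kernel of that map, which is `F(R)` because evaluation at `R` is left exact. This
gives the first isomorphism (`exists_pres_duality`, `nonempty_defect_duality_iso`).

For the second, evaluate the presentation of `D(F)` at `R`: `D(F)(R)` is the cokernel of `J(R)^* ⟶
I(R)^*`. Since `w` is contravariant and exact, `w(F)` is the cokernel of `w(J) ⟶ w(I)`. It remains
to compare `w(I)` with `I(R)^*`, naturally in `I`. The unit `I ⟶ (w(I), -)` yields a pairing between
`w(I)` and `I(R)`. If `I` is presented by a map `P ⟶ Q` of finitely generated projectives, then
`I(R)` is the cokernel of `Q^* ⟶ P^*`, so reflexivity of `P` and `Q` identifies `I(R)^*` with `ker(P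
⟶ Q) = w(I)` (`defectPairing_bijective`). A totally finitely presented `F` has a copresentation by
such `I` and `J`: it embeds into one, and the cokernel is again totally finitely presented
(`exists_mono_presentedBy_isFinProj`, `presentedBy_cokernel`).

For the tensor functor, a presentation `R^m ⟶ R^n ⟶ X ⟶ 0` has a transpose `R^n ⟶ R^m` that presents
`- ⊗_R X`. Its kernel consists of the tuples that satisfy the relations of `X`, that is, of the maps
`X ⟶ R`. -/

lemma projective_d_comp {X Y : C} (f : X ⟶ Y) : Projective.d f ≫ f = 0 :=
  (Category.assoc _ _ _).trans ((congrArg (Projective.π _ ≫ ·) (kernel.condition f)).trans comp_zero)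

/-- The chain complex `⋯ ⟶ P₁ ⟶ P₀` that continues `d : P₁ ⟶ P₀` by syzygies. -/
def syzygyComplex {P₁ P₀ : C} (d : P₁ ⟶ P₀) : ChainComplex C ℕ :=
  ChainComplex.mk' P₀ P₁ d (fun f => ⟨_, Projective.d f, projective_d_comp f⟩)

lemma syzygyComplex_d {P₁ P₀ : C} (d : P₁ ⟶ P₀) : (syzygyComplex d).d 1 0 = d := by
  simp [syzygyComplex]

/-- The objects of `syzygyComplex d` in degrees at least two are syzygies. -/
def syzygyComplexXIso {P₁ P₀ : C} (d : P₁ ⟶ P₀) (n : ℕ) : (syzygyComplex d).X (n + 2) ≅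
    Projective.syzygies ((syzygyComplex d).d (n + 1) n) :=
  ChainComplex.mk'XIso P₀ P₁ d (fun f => ⟨_, Projective.d f, projective_d_comp f⟩) n

lemma syzygyComplexXIso_hom_comp {P₁ P₀ : C} (d : P₁ ⟶ P₀) (n : ℕ) :
    (syzygyComplexXIso d n).hom ≫ Projective.d ((syzygyComplex d).d (n + 1) n) =
      (syzygyComplex d).d (n + 2) (n + 1) :=
  (ChainComplex.mk'_d P₀ P₁ d (fun f => ⟨_, Projective.d f, projective_d_comp f⟩) n).symm

/-- In degree `n + 2` the complex is, up to `syzygyComplexXIso`, a projective mapping onto the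
kernel of the differential below. -/
lemma syzygyComplex_exactAt_succ {P₁ P₀ : C} (d : P₁ ⟶ P₀) (n : ℕ) :
    (syzygyComplex d).ExactAt (n + 1) := by
  rw [HomologicalComplex.exactAt_iff' _ (n + 1 + 1) (n + 1) n (by simp) (by simp)]
  let K := syzygyComplex d
  let α : K.sc' (n + 2) (n + 1) n ⟶ ShortComplex.mk (Projective.d (K.d (n + 1) n)) (K.d (n + 1) n)
      (projective_d_comp _) :=
    { τ₁ := (syzygyComplexXIso d n).hom
      τ₂ := 𝟙 (K.X (n + 1))
      τ₃ := 𝟙 (K.X n)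
      comm₁₂ := (syzygyComplexXIso_hom_comp d n).trans (Category.comp_id _).symm
      comm₂₃ := (Category.id_comp _).trans (Category.comp_id _).symm }
  have h₁ : Epi α.τ₁ := inferInstanceAs (Epi (syzygyComplexXIso d n).hom)
  have h₂ : IsIso α.τ₂ := inferInstanceAs (IsIso (𝟙 (K.X (n + 1))))
  have h₃ : Mono α.τ₃ := inferInstanceAs (Mono (𝟙 (K.X n)))
  exact (ShortComplex.exact_iff_of_epi_of_isIso_of_mono α).2 (exact_d_f _)

lemma projective_syzygyComplex_X {P₁ P₀ : C} [h₁ : Projective P₁] [h₀ : Projective P₀] (d : P₁ ⟶ P₀)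
    (n : ℕ) : Projective ((syzygyComplex d).X n) := by
  obtain (_ | _ | n) := n
  · exact h₀
  · exact h₁
  · exact Projective.of_iso (syzygyComplexXIso d n).symm (Projective.projective_over _)

/-- A chain complex of projective objects that is exact in positive degrees is a projective
resolution of the cokernel of its last differential. -/
def resolutionOfExact (K : ChainComplex C ℕ) (hK : ∀ n, Projective (K.X n)) {X : C} (p : K.X 0 ⟶ X)
    (w : K.d 1 0 ≫ p = 0) (hex : (ShortComplex.mk (K.d 1 0) p w).Exact) (hp : Epi p)
    (h : ∀ n, K.ExactAt (n + 1)) : ProjectiveResolution X where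
  complex := K
  projective := hK
  π := (ChainComplex.toSingle₀Equiv _ _).symm ⟨p, w⟩
  quasiIso := ⟨fun n => by
    cases n
    · rw [ChainComplex.quasiIsoAt₀_iff, ShortComplex.quasiIso_iff_of_zeros']
      · refine (ShortComplex.exact_and_epi_g_iff_of_iso (?_ : _ ≅ ShortComplex.mk (K.d 1 0) p w)).2
          ⟨hex, hp⟩
        exact ShortComplex.isoMk (Iso.refl (K.X 1)) (Iso.refl (K.X 0)) (Iso.refl X)
          ((Category.id_comp _).trans (Category.comp_id _).symm)
          ((Category.id_comp _).trans ((ChainComplex.toSingle₀Equiv_symm_apply_f_zero _ _).symm.trans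
            (Category.comp_id _).symm))
      · exact K.shape _ _ (by simp)
      all_goals rfl
    · rw [quasiIsoAt_iff_exactAt']
      · exact h _
      · apply ChainComplex.exactAt_succ_single_obj⟩

/-- The projective resolution that extends an exact sequence `P₁ ⟶ P₀ ⟶ X ⟶ 0`. -/
def syzygyResolution {P₁ P₀ X : C} [Projective P₁] [Projective P₀] (d : P₁ ⟶ P₀) (p : P₀ ⟶ X)
    (w : d ≫ p = 0) (hex : (ShortComplex.mk d p w).Exact) [hp : Epi p] : ProjectiveResolution X :=
  -- The last differential of the complex equals `d` only propositionally, so exactness is carried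
  -- along an arbitrary `d' = d`.
  have h : ∀ (d' : P₁ ⟶ P₀), d' = d → ∃ w', (ShortComplex.mk d' p w').Exact := by
    rintro _ rfl
    exact ⟨w, hex⟩
  have h' := h _ (syzygyComplex_d d)
  resolutionOfExact (syzygyComplex d) (projective_syzygyComplex_X d) p h'.choose h'.choose_spec hp
    (syzygyComplex_exactAt_succ d)

/-- The zeroth left derived functor of `T` at `X` is the cokernel of `T(P₁) ⟶ T(P₀)` if
`P₁ ⟶ P₀ ⟶ X ⟶ 0` is exact and `P₁` and `P₀` are projective. -/
lemma leftDerived_zero_iso_cokernel {D : Type*} [Category* D] [Abelian D] (T : C ⥤ D) [T.Additive]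
    {P₁ P₀ X : C} [Projective P₁] [Projective P₀] (d : P₁ ⟶ P₀) (p : P₀ ⟶ X)
    (w : d ≫ p = 0) (hex : (ShortComplex.mk d p w).Exact) [Epi p] :
    Nonempty ((T.leftDerived 0).obj X ≅ cokernel (T.map d)) := by
  let K := (T.mapHomologicalComplex (ComplexShape.down ℕ)).obj (syzygyComplex d)
  have hK : K.d 1 0 = T.map d := congrArg (fun t => T.map t) (syzygyComplex_d d)
  -- Nothing leaves degree zero, so the homology there is the opcycles, i.e. the cokernel of the
  -- last differential.
  refine ⟨(syzygyResolution d p w hex).isoLeftDerivedObj T 0 ≪≫ K.isoHomologyι 0 _ rfl (by simp) ≪≫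
    (K.opcyclesIsCokernel 1 0 (by simp)).coconePointUniqueUpToIso (cokernelIsCokernel _) ≪≫
    cokernelIsoOfEq hK⟩

end Derived

/-! ### Presentations and the unit of the defect adjunction. -/

section Presentations

variable {C : Type u} [Category.{v} C] [Abelian C]

lemma Pres.of_iso {F G : C ⥤ AddCommGrpCat.{v}} {X Y : C} {f : X ⟶ Y} {x : F.obj X}
    (h : Pres F f x) (e : F ≅ G) : Pres G f (e.hom.app X x) := by
  have h₁ : ∀ (A : C) (a : F.obj A), e.inv.app A (e.hom.app A a) = a := fun A a =>
    congrArg (fun t => t.app A a) e.hom_inv_id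
  have h₂ : ∀ (A : C) (a : G.obj A), e.hom.app A (e.inv.app A a) = a := fun A a =>
    congrArg (fun t => t.app A a) e.inv_hom_id
  have := h.additive
  refine ⟨Functor.additive_of_iso e, ?_, fun A a => ?_, fun A g hg => ?_⟩
  · rw [← nat_apply, h.zero, map_zero]
  · obtain ⟨g, hg⟩ := h.surj A (e.inv.app A a)
    exact ⟨g, by rw [← nat_apply, hg, h₂]⟩
  · refine h.rel A g ?_
    rw [← h₁ A (F.map g x), nat_apply, hg, map_zero]

/-- A cokernel of `(Y, -) ⟶ (X, -)` in `fp(C, Ab)` is presented by `X ⟶ Y`. -/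
lemma exists_pres_of_iso_cokernel {G : FP C} {X Y : C} (d : X ⟶ Y)
    (e : G ≅ cokernel ((yonedaFP C).map d.op)) : ∃ x : G.obj.obj X, Pres G.obj d x := by
  obtain ⟨t, ht⟩ := exists_pres_cokerFP d
  -- The inclusion into all functors preserves cokernels, so the cokernel in `fp(C, Ab)` is the one
  -- underlying `cokerFP d`.
  have := (isFP (C := C)).preservesCokernels_ι ((yonedaFP C).map d.op)
  let i : (cokerFP d).obj ≅ G.obj :=
    ((isFP (C := C)).ι.mapIso e ≪≫ PreservesCokernel.iso (isFP (C := C)).ι _).symm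
  exact ⟨_, ht.of_iso i⟩

/-- The unit of the adjunction between the defect and the Yoneda embedding, at an element of
`F(A)`. -/
def unitElt (F : FP C) {A : C} (x : F.obj.obj A) : (defect C).obj (op F) ⟶ A :=
  ((defectAdjunction C).unit.app F).hom.app A x

lemma unitElt_map (F : FP C) {A B : C} (g : A ⟶ B) (x : F.obj.obj A) :
    unitElt F (F.obj.map g x) = unitElt F x ≫ g :=
  nat_apply ((defectAdjunction C).unit.app F).hom g x

lemma unitElt_add (F : FP C) {A : C} (x y : F.obj.obj A) :
    unitElt F (x + y) = unitElt F x + unitElt F y :=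
  map_add (((defectAdjunction C).unit.app F).hom.app A).hom x y

lemma unitElt_zero (F : FP C) {A : C} : unitElt F (0 : F.obj.obj A) = 0 :=
  map_zero (((defectAdjunction C).unit.app F).hom.app A).hom

lemma unitElt_naturality {F G : FP C} (m : F ⟶ G) {A : C} (x : F.obj.obj A) :
    unitElt G (m.hom.app A x) = (defect C).map m.op ≫ unitElt F x :=
  congrArg (fun t => t.hom.app A x) ((defectAdjunction C).unit.naturality m)

/-- If `F` is presented by `f : X ⟶ Y` and `x ∈ F(X)`, then `w(F) ⟶ X ⟶ Y` is exact. -/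
lemma Pres.exists_comp_unitElt {F : FP C} {X Y : C} {f : X ⟶ Y} {x : F.obj.obj X}
    (h : Pres F.obj f x) {A : C} (g : A ⟶ X) (hg : g ≫ f = 0) :
    ∃ k : A ⟶ (defect C).obj (op F), k ≫ unitElt F x = g := by
  -- As an element of `(A, -)(X)` killed by `f`, `g` defines a map `F ⟶ (A, -)`; its adjoint is the
  -- required factorization.
  obtain ⟨φ, hφ⟩ := h.exists_hom (H := FunctorDefect.homFunctor A) g hg
  let φ' : F ⟶ (yonedaFP C).obj (op A) := ObjectProperty.homMk φ
  let k := ((defectAdjunction C).homEquiv F (op A)).symm φ'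
  have hk : (defectAdjunction C).unit.app F ≫ (yonedaFP C).map k = φ' :=
    ((defectAdjunction C).homEquiv_unit _ _ k).symm.trans (Equiv.apply_symm_apply _ φ')
  exact ⟨k.unop, (congrArg (fun t => t.hom.app X x) hk).trans hφ⟩

/-- By adjunction, maps `A ⟶ w(F)` are maps `F ⟶ (A, -)`, and these are determined by their value on
the generator `x`. -/
lemma Pres.mono_unitElt {F : FP C} {X Y : C} {f : X ⟶ Y} {x : F.obj.obj X}
    (h : Pres F.obj f x) : Mono (unitElt F x) := by
  refine ⟨fun {A} k k' e => ?_⟩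
  let l : (defectOp C).obj F ⟶ op A := k.op
  let l' : (defectOp C).obj F ⟶ op A := k'.op
  have : (defectAdjunction C).homEquiv F (op A) l = (defectAdjunction C).homEquiv F (op A) l' := by
    rw [Adjunction.homEquiv_unit, Adjunction.homEquiv_unit]
    ext : 1
    exact h.hom_ext e
  exact Quiver.Hom.op_inj (((defectAdjunction C).homEquiv F (op A)).injective this)

lemma Pres.unitElt_comp {F : FP C} {X Y : C} {f : X ⟶ Y} {x : F.obj.obj X}
    (h : Pres F.obj f x) : unitElt F x ≫ f = 0 := by
  rw [← unitElt_map, h.zero, unitElt_zero]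

end Presentations

/-! ### Pointwise exactness in `fp(C, Ab)`. -/

section Exactness

variable {C : Type u} [Category.{v} C] [Abelian C]

/-- Exact sequences `0 ⟶ F ⟶ G ⟶ H` of finitely presented functors are pointwise exact. -/
lemma exists_app_eq_of_exact {F G H : FP C} {m : F ⟶ G} {δ : G ⟶ H} {w : m ≫ δ = 0}
    (hex : (ShortComplex.mk m δ w).Exact) [hm : Mono m] {A : C} (a : G.obj.obj A)
    (ha : δ.hom.app A a = 0) : ∃ b, m.hom.app A b = a := by
  have h₁ := hex.map_of_mono_of_preservesKernel (isFP (C := C)).ι hm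
    ((isFP (C := C)).preservesKernels_ι δ)
  exact (ShortComplex.ab_exact_iff _).1 (h₁.map ((evaluation C AddCommGrpCat.{v}).obj A)) a ha

lemma app_app_eq_zero {F G H : FP C} {m : F ⟶ G} {δ : G ⟶ H} (w : m ≫ δ = 0) {A : C}
    (a : F.obj.obj A) : δ.hom.app A (m.hom.app A a) = 0 :=
  congrArg (fun t => t.hom.app A a) w

end Exactness

/-! ### The defect as a kernel, in terms of elements. -/

section Linear

variable {A : Type u} [Ring A]

lemma nonempty_iso_of_range_eq {M M' N : ModuleCat.{u} A} (f : M ⟶ N) (g : M' ⟶ N)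
    (hf : Function.Injective f.hom) (hg : Function.Injective g.hom)
    (h : ∀ y, (∃ x, f.hom x = y) ↔ ∃ x, g.hom x = y) : Nonempty (M ≅ M') :=
  ⟨((LinearEquiv.ofInjective f.hom hf).trans ((LinearEquiv.ofEq _ _ (by
    ext y; exact h y)).trans (LinearEquiv.ofInjective g.hom hg).symm)).toModuleIso⟩

lemma nonempty_iso_of_ker_eq {L M M' : ModuleCat.{u} A} (f : L →ₗ[A] M) (g : L →ₗ[A] M')
    (hf : Function.Surjective f) (hg : Function.Surjective g) (h : ∀ x, f x = 0 ↔ g x = 0) :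
    Nonempty (M ≅ M') :=
  ⟨((f.quotKerEquivOfSurjective hf).symm.trans ((Submodule.quotEquivOfEq _ _ (by
    ext x; exact h x)).trans (g.quotKerEquivOfSurjective hg))).toModuleIso⟩

/-- The morphism from the ring that corresponds to an element of a module. -/
def eltHom {M : ModuleCat.{u} A} (x : M) : ModuleCat.of A A ⟶ M :=
  ModuleCat.ofHom (LinearMap.toSpanSingleton A M x)

lemma eltHom_one {M : ModuleCat.{u} A} (x : M) : (eltHom x).hom (1 : A) = x := one_smul A x

lemma eltHom_comp {M N : ModuleCat.{u} A} (x : M) (f : M ⟶ N) : eltHom x ≫ f = eltHom (f.hom x) := by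
  apply ModuleCat.hom_ext
  apply LinearMap.ext_ring
  exact (congrArg f.hom (eltHom_one x)).trans (eltHom_one _).symm

lemma eltHom_zero {M : ModuleCat.{u} A} : eltHom (0 : M) = 0 := by
  apply ModuleCat.hom_ext
  exact LinearMap.toSpanSingleton_zero A M

lemma Pres.unitElt_injective {F : FP (ModuleCat.{u} A)} {X Y : ModuleCat.{u} A} {f : X ⟶ Y}
    {x : F.obj.obj X} (h : Pres F.obj f x) : Function.Injective (unitElt F x).hom :=
  (ModuleCat.mono_iff_injective _).1 h.mono_unitElt

/-- An element `y` of `X` is a morphism from the ring to `X`, so the factorization of morphisms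
through `w(F)` applies to it. -/
lemma Pres.exists_unitElt_eq_iff {F : FP (ModuleCat.{u} A)} {X Y : ModuleCat.{u} A} {f : X ⟶ Y}
    {x : F.obj.obj X} (h : Pres F.obj f x) (y : X) :
    (∃ k, (unitElt F x).hom k = y) ↔ f.hom y = 0 := by
  constructor
  · rintro ⟨k, rfl⟩
    exact congrArg (fun t => t.hom k) h.unitElt_comp
  · intro hy
    obtain ⟨k, hk⟩ := h.exists_comp_unitElt (eltHom y) (by rw [eltHom_comp, hy, eltHom_zero])
    exact ⟨k.hom (1 : A), (congrArg (fun t => t.hom (1 : A)) hk).trans (eltHom_one y)⟩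

end Linear

/-! ### The isomorphism `w(D(F)) ≅ F(A)`. -/

section Duality

variable {A B : Type u} [Ring A] [Ring B] (e : B ≃+* Aᵐᵒᵖ)

/-- An injective copresentation `0 ⟶ F ⟶ I ⟶ J` induces a presentation of `D(F)` by
`I(A) ⟶ J(A)`. -/
lemma exists_pres_duality {F I J : FP (ModuleCat.{u} A)} [Injective I] [Injective J] {m : F ⟶ I}
    {δ : I ⟶ J} {w : m ≫ δ = 0} (hex : (ShortComplex.mk m δ w).Exact) [Mono m] :
    ∃ x, Pres ((duality e).obj (op F)).obj ((evalRing e).map δ) x := by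
  -- In the opposite category the copresentation is a projective presentation of `F`.
  obtain ⟨i⟩ := leftDerived_zero_iso_cokernel (evalYoneda e) δ.op m.op
    (congrArg Quiver.Hom.op w) hex.op
  exact exists_pres_of_iso_cokernel _ i

/-- `w(D(F)) ≅ F(A)`. -/
theorem nonempty_defect_duality_iso (F : FP (ModuleCat.{u} A)) :
    Nonempty ((defect (ModuleCat.{u} B)).obj (op ((duality e).obj (op F))) ≅
      (evalRing e).obj F) := by
  let m := Injective.ι F
  let δ := cokernel.π m ≫ Injective.ι (cokernel m)
  have w : m ≫ δ = 0 := by simp [δ]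
  have hex : (ShortComplex.mk m δ w).Exact := exact_f_d m
  obtain ⟨x, hx⟩ := exists_pres_duality e hex
  -- Both modules embed into `I(A)`, with image the kernel of `I(A) ⟶ J(A)`.
  refine nonempty_iso_of_range_eq (unitElt _ x) ((evalRing e).map m) hx.unitElt_injective
    (injective_of_mono m _) fun y => ?_
  rw [hx.exists_unitElt_eq_iff]
  refine ⟨fun hy => exists_app_eq_of_exact hex _ hy, ?_⟩
  rintro ⟨b, rfl⟩
  exact app_app_eq_zero w b

end Duality

/-! ### The pairing of `w(F)` with `F(R)` and the isomorphism `w(F) ≅ D(F)(R)`. -/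

section Pairing

variable {R : Type u} [Ring R]

/-- The natural pairing between `w(F)` and `F(R)`. -/
def defectPairing (F : FP (ModuleCat.{u} Rᵐᵒᵖ)) : (defect (ModuleCat.{u} Rᵐᵒᵖ)).obj (op F) →ₗ[Rᵐᵒᵖ]
    ((evalRing (RingEquiv.opOp R)).obj F →ₗ[R] R) where
  toFun k :=
    -- The unit turns `x ∈ F(R)` into a morphism `w(F) ⟶ R`, which is evaluated at `k`.
    { toFun := fun x => MulOpposite.unop ((unitElt F (A := ModuleCat.of Rᵐᵒᵖ Rᵐᵒᵖ) x).hom k)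
      map_add' := fun x y => congrArg (fun t => MulOpposite.unop (t.hom k)) (unitElt_add F x y)
      map_smul' := fun r x => congrArg (fun t => MulOpposite.unop (t.hom k))
        (unitElt_map F (rightMul Rᵐᵒᵖ (RingEquiv.opOp R r)) x) }
  map_add' k k' := by
    ext x
    exact congrArg MulOpposite.unop (map_add (unitElt F (A := ModuleCat.of Rᵐᵒᵖ Rᵐᵒᵖ) x).hom k k')
  map_smul' s k := by
    ext x
    exact congrArg MulOpposite.unop (map_smul (unitElt F (A := ModuleCat.of Rᵐᵒᵖ Rᵐᵒᵖ) x).hom s k)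

/-- When `x` generates `F`, every element of `F(R)` is some `F(g)(x)`, so this formula determines
the pairing. -/
lemma defectPairing_apply (F : FP (ModuleCat.{u} Rᵐᵒᵖ)) (k : (defect (ModuleCat.{u} Rᵐᵒᵖ)).obj (op F))
    {X : ModuleCat.{u} Rᵐᵒᵖ} (x : F.obj.obj X) (g : X ⟶ ModuleCat.of Rᵐᵒᵖ Rᵐᵒᵖ) :
    defectPairing F k (show (evalRing (RingEquiv.opOp R)).obj F from F.obj.map g x) =
      MulOpposite.unop (g.hom ((unitElt F x).hom k)) :=
  congrArg (fun t : (defect _).obj (op F) ⟶ ModuleCat.of Rᵐᵒᵖ Rᵐᵒᵖ => MulOpposite.unop (t.hom k))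
    (unitElt_map F g x)

/-- Naturality of the unit: under the pairing, `w(m)` becomes the transpose of `m(R)`. -/
lemma defectPairing_map {F G : FP (ModuleCat.{u} Rᵐᵒᵖ)} (m : F ⟶ G)
    (k : (defect (ModuleCat.{u} Rᵐᵒᵖ)).obj (op G)) :
    defectPairing F (((defect _).map m.op).hom k) =
      defectPairing G k ∘ₗ ((evalRing (RingEquiv.opOp R)).map m).hom := by
  ext x
  exact (congrArg (fun t => MulOpposite.unop (t.hom k))
    (unitElt_naturality m (A := ModuleCat.of Rᵐᵒᵖ Rᵐᵒᵖ) x)).symm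

/-- Existence of a finite dual basis, in particular for finitely generated projective modules. -/
lemma exists_finite_dual_basis (A : Type*) [Ring A] (P : Type*) [AddCommGroup P] [Module A P]
    [Module.Finite A P] [Module.Projective A P] :
    ∃ (n : ℕ) (b : Fin n → P) (c : Fin n → (P →ₗ[A] A)), ∀ x, ∑ i, c i x • b i = x := by
  obtain ⟨n, f, g, -, -, h⟩ := Module.Finite.exists_comp_eq_id_of_projective A P
  refine ⟨n, fun i => f (Pi.single i 1), fun i => LinearMap.proj i ∘ₗ g, fun x => ?_⟩
  conv_rhs => rw [← LinearMap.id_apply (R := A) x, ← h, LinearMap.comp_apply, pi_eq_sum_univ' (g x),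
    map_sum]
  refine Finset.sum_congr rfl fun i _ => ?_
  rw [map_smul]
  simp

lemma eq_zero_of_forall_linearMap {A : Type*} [Ring A] {P : Type*} [AddCommGroup P] [Module A P]
    [Module.Finite A P] [Module.Projective A P] {x : P} (h : ∀ g : P →ₗ[A] A, g x = 0) : x = 0 := by
  obtain ⟨n, b, c, hbc⟩ := exists_finite_dual_basis A P
  rw [← hbc x]
  simp [h]

variable {F : FP (ModuleCat.{u} Rᵐᵒᵖ)} {P Q : ModuleCat.{u} Rᵐᵒᵖ} {d : P ⟶ Q} {t : F.obj.obj P}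

/-- Regard `k` as an element of `P`. Pairing it with `F(g)(t)` gives `g(k)`, and linear forms
separate the points of `P`. -/
lemma Pres.defectPairing_injective [Module.Finite Rᵐᵒᵖ P] [Module.Projective Rᵐᵒᵖ P]
    (h : Pres F.obj d t) : Function.Injective (defectPairing F) := by
  rw [injective_iff_map_eq_zero]
  intro k hk
  apply h.unitElt_injective
  rw [map_zero]
  refine eq_zero_of_forall_linearMap (A := Rᵐᵒᵖ) fun g => ?_
  have h₁ := defectPairing_apply F k t (ModuleCat.ofHom g : P ⟶ ModuleCat.of Rᵐᵒᵖ Rᵐᵒᵖ)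
  rw [hk] at h₁
  exact MulOpposite.unop_injective h₁.symm

/-- For a functor presented by finitely generated projective modules, the pairing identifies `w(F)`
with the dual of `F(R)`. -/
lemma Pres.defectPairing_surjective [Module.Finite Rᵐᵒᵖ P] [Module.Projective Rᵐᵒᵖ P]
    [Module.Finite Rᵐᵒᵖ Q] [Module.Projective Rᵐᵒᵖ Q] (h : Pres F.obj d t) :
    Function.Surjective (defectPairing F) := by
  intro ψ
  obtain ⟨n, b, c, hbc⟩ := exists_finite_dual_basis Rᵐᵒᵖ P
  have := h.additive
  -- `E` is the quotient map `P^* ⟶ F(R)` of the presentation.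
  let E (g : P →ₗ[Rᵐᵒᵖ] Rᵐᵒᵖ) : (evalRing (RingEquiv.opOp R)).obj F :=
    F.obj.map (ModuleCat.ofHom g : P ⟶ ModuleCat.of Rᵐᵒᵖ Rᵐᵒᵖ) t
  have E_add (g g') : E (g + g') = E g + E g' :=
    map_add_apply F.obj (ModuleCat.ofHom g : P ⟶ ModuleCat.of Rᵐᵒᵖ Rᵐᵒᵖ) (ModuleCat.ofHom g') t
  let E' : (P →ₗ[Rᵐᵒᵖ] Rᵐᵒᵖ) →+ (evalRing (RingEquiv.opOp R)).obj F := AddMonoidHom.mk' E E_add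
  -- By reflexivity of `P`, the form `ψ ∘ E` on `P^*` is evaluation at a point `p`, whose
  -- coordinates are its values on the dual basis.
  let p : P := ∑ i, MulOpposite.op (ψ (E (c i))) • b i
  have hp (g : P →ₗ[Rᵐᵒᵖ] Rᵐᵒᵖ) : g p = MulOpposite.op (ψ (E g)) := by
    have hg : g = ∑ i, LinearMap.toSpanSingleton Rᵐᵒᵖ Rᵐᵒᵖ (g (b i)) ∘ₗ c i := by
      ext x
      conv_lhs => rw [← hbc x]
      simp
    have hE (i) : E (LinearMap.toSpanSingleton Rᵐᵒᵖ Rᵐᵒᵖ (g (b i)) ∘ₗ c i) =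
        MulOpposite.unop (g (b i)) • E (c i) :=
      map_comp_apply' F.obj (ModuleCat.ofHom (c i) : P ⟶ ModuleCat.of Rᵐᵒᵖ Rᵐᵒᵖ) _ t
    have h₁ : E g = ∑ i, MulOpposite.unop (g (b i)) • E (c i) := by
      conv_lhs => rw [hg]
      exact (map_sum E' _ _).trans (Finset.sum_congr rfl fun i _ => hE i)
    rw [h₁, map_sum, map_sum]
    simp
  -- Forms that factor through `d` are killed by `E`, so every form on `Q` vanishes at `d(p)`.
  have hdp : d.hom p = 0 := by
    refine eq_zero_of_forall_linearMap (A := Rᵐᵒᵖ) fun g => ?_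
    have h₁ : E (g ∘ₗ d.hom) = 0 := by
      refine (map_comp_apply' F.obj d (ModuleCat.ofHom g : Q ⟶ ModuleCat.of Rᵐᵒᵖ Rᵐᵒᵖ) t).trans ?_
      rw [h.zero]
      exact map_zero _
    have h₂ := hp (g ∘ₗ d.hom)
    rw [h₁, map_zero] at h₂
    exact h₂
  obtain ⟨k, hk⟩ := (h.exists_unitElt_eq_iff p).2 hdp
  refine ⟨k, ?_⟩
  ext x
  obtain ⟨g, rfl⟩ := h.surj (ModuleCat.of Rᵐᵒᵖ Rᵐᵒᵖ) x
  refine (defectPairing_apply F k t g).trans ?_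
  refine (congrArg (fun y => MulOpposite.unop (g.hom y)) hk).trans ?_
  exact congrArg MulOpposite.unop (hp g.hom)

/-- `w(F) ≅ D(F)(R)` if `F` has an injective copresentation by functors that are presented by
finitely generated projective modules. -/
theorem nonempty_defect_iso_eval_duality {F I J : FP (ModuleCat.{u} Rᵐᵒᵖ)} [Injective I]
    [Injective J] {m : F ⟶ I} {δ : I ⟶ J} {w : m ≫ δ = 0} (hex : (ShortComplex.mk m δ w).Exact)
    [Mono m] (hI : Function.Bijective (defectPairing I)) (hJ : Function.Bijective (defectPairing J)) :
    Nonempty ((defect (ModuleCat.{u} Rᵐᵒᵖ)).obj (op F) ≅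
      (evalRing (RingEquiv.refl Rᵐᵒᵖ)).obj ((duality (RingEquiv.opOp R)).obj (op F))) := by
  obtain ⟨x, hx⟩ := exists_pres_duality (RingEquiv.opOp R) hex
  have := hx.additive
  let D := (duality (RingEquiv.opOp R)).obj (op F)
  let E := (evalRing (RingEquiv.opOp R)).obj I
  -- `σ` is the quotient map `I(R)^* ⟶ D(F)(R)`; its kernel consists of the forms that factor
  -- through `I(R) ⟶ J(R)`.
  let σ : (E →ₗ[R] R) →ₗ[Rᵐᵒᵖ] (evalRing (RingEquiv.refl Rᵐᵒᵖ)).obj D :=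
    { toFun := fun h => D.obj.map (ModuleCat.ofHom h : E ⟶ ModuleCat.of R R) x
      map_add' := fun h h' =>
        map_add_apply D.obj (ModuleCat.ofHom h : E ⟶ ModuleCat.of R R) (ModuleCat.ofHom h') x
      map_smul' := fun s h =>
        map_comp_apply' D.obj (ModuleCat.ofHom h : E ⟶ ModuleCat.of R R) (rightMul R s) x }
  have hw : PreservesFiniteLimits (defectOp (ModuleCat.{u} Rᵐᵒᵖ)) := defectOp_exact.1
  have hw' : PreservesFiniteColimits (defectOp (ModuleCat.{u} Rᵐᵒᵖ)) := defectOp_exact.2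
  have := (defectAdjunction (ModuleCat.{u} Rᵐᵒᵖ)).left_adjoint_additive
  -- Exactness of the defect: `w(J) ⟶ w(I) ⟶ w(F) ⟶ 0` is exact.
  have hw₁ : ∀ k, ((defect (ModuleCat.{u} Rᵐᵒᵖ)).map m.op).hom k = 0 →
      ∃ l, ((defect (ModuleCat.{u} Rᵐᵒᵖ)).map δ.op).hom l = k :=
    (ShortComplex.moduleCat_exact_iff _).1 (hex.map (defectOp _)).unop
  have hw₂ : Function.Surjective ((defect (ModuleCat.{u} Rᵐᵒᵖ)).map m.op).hom := by
    rw [← ModuleCat.epi_iff_surjective]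
    exact inferInstanceAs (Epi ((defectOp (ModuleCat.{u} Rᵐᵒᵖ)).map m).unop)
  -- Both sides are quotients of `w(I)`, and it suffices that the kernels agree.
  refine nonempty_iso_of_ker_eq ((defect (ModuleCat.{u} Rᵐᵒᵖ)).map m.op).hom
    (σ ∘ₗ defectPairing I) hw₂ ?_ fun k => ⟨fun hk => ?_, fun hk => ?_⟩
  · intro y
    obtain ⟨g, hg⟩ := hx.surj (ModuleCat.of R R) y
    obtain ⟨k, hk⟩ := hI.2 g.hom
    exact ⟨k, (congrArg σ hk).trans hg⟩
  · obtain ⟨l, rfl⟩ := hw₁ k hk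
    rw [LinearMap.comp_apply, defectPairing_map]
    refine (map_comp_apply' D.obj ((evalRing (RingEquiv.opOp R)).map δ)
      (ModuleCat.ofHom (defectPairing J l) : _ ⟶ ModuleCat.of R R) x).trans ?_
    rw [hx.zero]
    exact map_zero _
  -- The form of `k` factors through `J(R)` as `v`. Surjectivity of the pairing for `J` gives `l`
  -- with form `v`; injectivity for `I` shows that `k` is the image of `l`.
  · obtain ⟨v, hv⟩ := hx.rel (ModuleCat.of R R) (ModuleCat.ofHom (defectPairing I k)) hk
    obtain ⟨l, hl⟩ := hJ.2 v.hom
    have h₁ : k = ((defect _).map δ.op).hom l := by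
      apply hI.1
      rw [defectPairing_map, hl]
      exact congrArg ModuleCat.Hom.hom hv.symm
    rw [h₁]
    refine congrArg (fun t => t.hom l)
      (?_ : (defect (ModuleCat.{u} Rᵐᵒᵖ)).map δ.op ≫ (defect _).map m.op = 0)
    rw [← Functor.map_comp, ← op_comp, w]
    exact congrArg Quiver.Hom.unop ((defectOp (ModuleCat.{u} Rᵐᵒᵖ)).map_zero F J)

end Pairing

/-! ### Cokernels and injective embeddings of presented functors. -/

section Presentations

variable {C : Type u} [Category.{v} C] [Abelian C]

/-- Lift `F ⟶ G` to a map `h : X' ⟶ X` of presenting objects. The cokernel keeps the generator of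
`G` and gains the relation `h`, so `(h, f') : X' ⟶ X ⊞ Y'` presents it. -/
lemma presentedBy_cokernel (P : ObjectProperty C) (hP : ∀ X Y, P X → P Y → P (X ⊞ Y)) {F G : FP C}
    (m : F ⟶ G) (hF : presentedBy P F.obj) (hG : presentedBy P G.obj) :
    presentedBy P (cokernel m).obj := by
  let q := cokernel.π m
  let S := ShortComplex.mk m q (cokernel.condition m)
  have hS : (S.map (isFP (C := C)).ι).Exact :=
    (S.exact_of_g_is_cokernel (cokernelIsCokernel m)).map_of_epi_of_preservesCokernel
      (isFP (C := C)).ι (inferInstanceAs (Epi (cokernel.π m)))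
      ((isFP (C := C)).preservesCokernels_ι m)
  have hex : ∀ (A : C) (a : G.obj.obj A), q.hom.app A a = 0 → ∃ b, m.hom.app A b = a :=
    fun A => (ShortComplex.ab_exact_iff _).1 (hS.map ((evaluation C AddCommGrpCat.{v}).obj A))
  have hqm : ∀ (A : C) (a : F.obj.obj A), q.hom.app A (m.hom.app A a) = 0 := fun A a =>
    app_app_eq_zero (cokernel.condition m) a
  have hsurj : ∀ A, Function.Surjective (q.hom.app A) := fun A => by
    have := (isFP (C := C)).preservesEpimorphisms_ι_of_isNormalMonoCategory
    have : Epi q.hom := inferInstanceAs (Epi ((isFP (C := C)).ι.map (cokernel.π m)))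
    exact (AddCommGrpCat.epi_iff_surjective (q.hom.app A)).1 inferInstance
  rw [presentedBy_iff] at hF hG ⊢
  obtain ⟨X, Y, f, x, hX, hY, hF⟩ := hF
  obtain ⟨X', Y', f', x', hX', hY', hG⟩ := hG
  obtain ⟨h, hh⟩ := hG.surj X (m.hom.app X x)
  refine ⟨X', X ⊞ Y', biprod.lift h f', q.hom.app X' x', hX', hP _ _ hX hY',
    ⟨inferInstance, ?_, ?_, ?_⟩⟩
  · rw [biprod.lift_eq, ← nat_apply, map_add_apply, map_comp_apply', map_comp_apply', hG.zero,
      map_zero, add_zero, hh, ← nat_apply, hqm]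
  · intro A a
    obtain ⟨a, rfl⟩ := hsurj A a
    obtain ⟨g, rfl⟩ := hG.surj A a
    exact ⟨g, by rw [nat_apply]⟩
  · intro A g hg
    obtain ⟨a, ha⟩ := hex A (G.obj.map g x') (by rw [nat_apply, hg])
    obtain ⟨c, rfl⟩ := hF.surj A a
    obtain ⟨w, hw⟩ := hG.rel A (g - h ≫ c) (by
      rw [map_sub_apply, map_comp_apply', hh, ← nat_apply, ha, sub_self])
    exact ⟨biprod.desc c w, by rw [biprod.lift_desc, hw]; abel⟩

/-- A functor presented by `X ⟶ Y` embeds into an injective one, presented by projective objects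
that map onto `X`, onto `Y` and onto the kernel of the latter map. -/
lemma Pres.exists_mono_injective {F : FP C} {X Y : C} {f : X ⟶ Y} {x : F.obj.obj X}
    (hF : Pres F.obj f x) {P Q K : C} [Projective P] [Projective Q] (p : P ⟶ X)
    [Epi p] (q : Q ⟶ Y) [Epi q] (k : K ⟶ Q) (hkq : k ≫ q = 0)
    (hk : (ShortComplex.mk k q hkq).Exact) :
    ∃ (I : FP C) (d : P ⊞ K ⟶ Q) (t : I.obj.obj (P ⊞ K)) (m : F ⟶ I), Mono m ∧ Pres I.obj d t := by
  let d := Projective.factorThru (p ≫ f) q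
  have hd : d ≫ q = p ≫ f := Projective.factorThru_comp _ _
  obtain ⟨t, ht⟩ := exists_pres_cokerFP (biprod.desc d k)
  let I := cokerFP (biprod.desc d k)
  -- The square with `(p, 0)` and `q` as vertical maps commutes, so `x ↦ I(p, 0)(t)` respects the
  -- relation `f`.
  obtain ⟨φ, hφ⟩ := hF.exists_hom (H := I.obj) (I.obj.map (biprod.desc p 0) t) (by
    have : biprod.desc p 0 ≫ f = biprod.desc d k ≫ q := by
      ext <;> simp [hd, hkq]
    rw [← map_comp_apply', this, map_comp_apply', ht.zero, map_zero])
  refine ⟨I, biprod.desc d k, t, ObjectProperty.homMk φ, mono_of_injective _ fun A a ha => ?_, ht⟩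
  obtain ⟨g, rfl⟩ := hF.surj A a
  change φ.app A (F.obj.map g x) = 0 at ha
  rw [nat_apply, hφ, ← map_comp_apply'] at ha
  -- If `F(g)(x)` maps to zero, then `(p ≫ g, 0)` factors through `(d, k)` as `u`. As `u` kills `k`,
  -- it descends along `q` to `v`, and `f ≫ v = g` because `p` is epi.
  obtain ⟨u, hu⟩ := ht.rel _ _ ha
  have hu₁ : d ≫ u = p ≫ g := by simpa using congrArg (biprod.inl ≫ ·) hu
  have hu₂ : k ≫ u = 0 := by simpa using congrArg (biprod.inr ≫ ·) hu
  obtain ⟨v, rfl⟩ : ∃ v, q ≫ v = u := ⟨hk.desc u hu₂, hk.g_desc u hu₂⟩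
  have : f ≫ v = g := by
    rw [← cancel_epi p, ← hu₁, ← Category.assoc, ← hd, Category.assoc]
  rw [← this, map_comp_apply', hF.zero, map_zero]

end Presentations

/-! ### Copresentations of totally finitely presented functors by finitely generated projectives. -/

section FiniteProjective

variable (A : Type u) [Ring A]

/-- The finitely generated projective `A`-modules. -/
def isFinProj : ObjectProperty (ModuleCat.{u} A) := fun M => Module.Finite A M ∧ Module.Projective A M

variable {A}

lemma isFinPres_of_isFinProj {M : ModuleCat.{u} A} (h : isFinProj A M) : isFinPres A M :=
  have := h.1
  have := h.2
  Module.finitePresentation_of_projective A M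

lemma isFinProj_biprod {M N : ModuleCat.{u} A} (hM : isFinProj A M) (hN : isFinProj A N) :
    isFinProj A (M ⊞ N) := by
  obtain ⟨_, _⟩ := hM
  obtain ⟨_, _⟩ := hN
  let i := (ModuleCat.biprodIsoProd M N).toLinearEquiv.symm
  exact ⟨Module.Finite.equiv i, Module.Projective.of_equiv i⟩

lemma isFinPres_biprod {M N : ModuleCat.{u} A} (hM : isFinPres A M) (hN : isFinPres A N) :
    isFinPres A (M ⊞ N) := by
  have : Module.FinitePresentation A M := hM
  have : Module.FinitePresentation A N := hN
  exact Module.FinitePresentation.of_equiv (ModuleCat.biprodIsoProd M N).toLinearEquiv.symm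

lemma exists_isFinProj_epi (M : ModuleCat.{u} A) [Module.Finite A M] :
    ∃ (P : ModuleCat.{u} A) (p : P ⟶ M), isFinProj A P ∧ Epi p := by
  obtain ⟨n, f, hf⟩ := Module.Finite.exists_fin' A M
  exact ⟨ModuleCat.of A (Fin n → A), ModuleCat.ofHom f,
    ⟨inferInstanceAs (Module.Finite A (Fin n → A)), inferInstanceAs (Module.Projective A (Fin n → A))⟩,
    (ModuleCat.epi_iff_surjective _).2 hf⟩

lemma isTFP_of_presentedBy_isFinProj {F : ModuleCat.{u} A ⥤ AddCommGrpCat.{u}}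
    (h : presentedBy (isFinProj A) F) : isTFP A F := by
  obtain ⟨X, Y, α, hX, hY, e⟩ := h
  exact ⟨X, Y, α, isFinPres_of_isFinProj hX, isFinPres_of_isFinProj hY, e⟩

lemma injective_of_presentedBy_isFinProj {I : FP (ModuleCat.{u} A)}
    (h : presentedBy (isFinProj A) I.obj) : Injective I := by
  obtain ⟨P, Q, d, t, ⟨_, hP⟩, ⟨_, hQ⟩, h⟩ := (presentedBy_iff _ _).1 h
  have := (IsProjective.iff_projective P).1 hP
  have := (IsProjective.iff_projective Q).1 hQ
  exact h.injective

/-- Totally finitely presented functors embed into functors presented by finitely generated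
projective modules. -/
lemma exists_mono_presentedBy_isFinProj (F : FP (ModuleCat.{u} A)) (hF : isTFP A F.obj) :
    ∃ (I : FP (ModuleCat.{u} A)) (m : F ⟶ I), Mono m ∧ presentedBy (isFinProj A) I.obj := by
  obtain ⟨X, Y, f, x, hX, hY, hF⟩ := (presentedBy_iff _ _).1 hF
  have : Module.FinitePresentation A X := hX
  have : Module.FinitePresentation A Y := hY
  obtain ⟨P, p, hP, _⟩ := exists_isFinProj_epi X
  obtain ⟨Q, q, hQ, hq⟩ := exists_isFinProj_epi Y
  have := hQ.1
  -- Finite presentation of `Y` makes the kernel of `Q ⟶ Y` finitely generated, so `K` can be chosen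
  -- finitely generated projective.
  have hfg := Module.FinitePresentation.fg_ker q.hom ((ModuleCat.epi_iff_surjective _).1 hq)
  have : Module.Finite A (ModuleCat.of A (LinearMap.ker q.hom)) := Module.Finite.iff_fg.2 hfg
  obtain ⟨K, k, hK, hk⟩ := exists_isFinProj_epi (ModuleCat.of A (LinearMap.ker q.hom))
  have hkq : (k ≫ ModuleCat.ofHom (LinearMap.ker q.hom).subtype) ≫ q = 0 := by
    ext y
    exact (k.hom y).2
  have := (IsProjective.iff_projective P).1 hP.2
  have := (IsProjective.iff_projective Q).1 hQ.2
  obtain ⟨I, d, t, m, hm, hI⟩ := hF.exists_mono_injective p q _ hkq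
    ((ShortComplex.moduleCat_exact_iff _).2 fun y hy => by
      obtain ⟨z, hz⟩ := (ModuleCat.epi_iff_surjective _).1 hk ⟨y, hy⟩
      exact ⟨z, congrArg Subtype.val hz⟩)
  exact ⟨I, m, hm, (presentedBy_iff _ _).2 ⟨_, _, d, t, isFinProj_biprod hP hK, hQ, hI⟩⟩

lemma defectPairing_bijective {R : Type u} [Ring R] {I : FP (ModuleCat.{u} Rᵐᵒᵖ)}
    (h : presentedBy (isFinProj Rᵐᵒᵖ) I.obj) : Function.Bijective (defectPairing I) := by
  obtain ⟨P, Q, d, t, ⟨_, _⟩, ⟨_, _⟩, h⟩ := (presentedBy_iff _ _).1 h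
  exact ⟨h.defectPairing_injective, h.defectPairing_surjective⟩

/-- `w(F) ≅ D(F)(R)` for totally finitely presented `F`. -/
theorem nonempty_defect_iso_eval_duality_of_isTFP {R : Type u} [Ring R]
    (F : FP (ModuleCat.{u} Rᵐᵒᵖ)) (hF : isTFP Rᵐᵒᵖ F.obj) :
    Nonempty ((defect (ModuleCat.{u} Rᵐᵒᵖ)).obj (op F) ≅
      (evalRing (RingEquiv.refl Rᵐᵒᵖ)).obj ((duality (RingEquiv.opOp R)).obj (op F))) := by
  obtain ⟨I, m, hm, hI⟩ := exists_mono_presentedBy_isFinProj F hF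
  obtain ⟨J, m', hm', hJ⟩ := exists_mono_presentedBy_isFinProj (cokernel m)
    (presentedBy_cokernel _ (fun _ _ => isFinPres_biprod) m hF (isTFP_of_presentedBy_isFinProj hI))
  have := injective_of_presentedBy_isFinProj hI
  have := injective_of_presentedBy_isFinProj hJ
  -- Following the cokernel by a monomorphism does not affect exactness at `I`.
  have hex : (ShortComplex.mk m (cokernel.π m ≫ m') (by simp)).Exact := by
    let S := ShortComplex.mk m (cokernel.π m) (cokernel.condition m)
    let α : S ⟶ ShortComplex.mk m (cokernel.π m ≫ m') (by simp) :=
      { τ₁ := 𝟙 _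
        τ₂ := 𝟙 _
        τ₃ := m' }
    have h₁ : Epi α.τ₁ := inferInstanceAs (Epi (𝟙 F))
    have h₂ : IsIso α.τ₂ := inferInstanceAs (IsIso (𝟙 I))
    have h₃ : Mono α.τ₃ := hm'
    exact (ShortComplex.exact_iff_of_epi_of_isIso_of_mono α).1
      (S.exact_of_g_is_cokernel (cokernelIsCokernel m))
  exact nonempty_defect_iso_eval_duality hex (defectPairing_bijective hI) (defectPairing_bijective hJ)

end FiniteProjective

/-! ### The tensor functor: its presentation and its defect. -/

section TensorPresentation

variable {R : Type u} [Ring R]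

open TensorProduct

/-- The element `m ⊗ x` of `M ⊗_R X`. -/
def tensorMk (M : ModuleCat.{u} Rᵐᵒᵖ) (X : ModuleCat.{u} R) : M →+ X →+ (tensorFunctor X).obj M :=
  AddMonoidHom.mk' (fun m => AddMonoidHom.mk'
      (fun x => (QuotientAddGroup.mk (m ⊗ₜ[ℤ] x) : (M ⊗[ℤ] X) ⧸ balancedRel M X))
      (fun x y => congrArg QuotientAddGroup.mk (TensorProduct.tmul_add m x y)))
    (fun m m' => by
      ext x
      exact congrArg (QuotientAddGroup.mk (s := balancedRel M X)) (TensorProduct.add_tmul m m' x))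

lemma tensorMk_smul {M : ModuleCat.{u} Rᵐᵒᵖ} {X : ModuleCat.{u} R} (m : M) (r : R) (x : X) :
    tensorMk M X (MulOpposite.op r • m) x = tensorMk M X m (r • x) := by
  refine (QuotientAddGroup.eq_iff_sub_mem (N := balancedRel M X)).2 ?_
  exact AddSubgroup.subset_closure ⟨m, r, x, rfl⟩

lemma tensorFunctor_map_mk {M N : ModuleCat.{u} Rᵐᵒᵖ} {X : ModuleCat.{u} R} (g : M ⟶ N) (m : M)
    (x : X) : (tensorFunctor X).map g (tensorMk M X m x) = tensorMk N X (g.hom m) x := rfl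

lemma tensor_induction {M : ModuleCat.{u} Rᵐᵒᵖ} {X : ModuleCat.{u} R}
    {p : (tensorFunctor X).obj M → Prop} (h₀ : p 0) (hm : ∀ m x, p (tensorMk M X m x))
    (ha : ∀ a b, p a → p b → p (a + b)) (a : (tensorFunctor X).obj M) : p a := by
  obtain ⟨a, rfl⟩ := QuotientAddGroup.mk_surjective (s := balancedRel M X) a
  induction a using TensorProduct.induction_on with
  | zero => exact h₀
  | tmul m x => exact hm m x
  | add a b h h' => exact ha _ _ h h'

lemma exists_tensor_lift {M : ModuleCat.{u} Rᵐᵒᵖ} {X : ModuleCat.{u} R} {T : Type*} [AddCommGroup T]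
    (β : M →+ X →+ T) (hβ : ∀ m (r : R) x, β (MulOpposite.op r • m) x = β m (r • x)) :
    ∃ φ : (tensorFunctor X).obj M →+ T, ∀ m x, φ (tensorMk M X m x) = β m x := by
  let φ : M ⊗[ℤ] X →+ T := TensorProduct.liftAddHom β (fun n m x => by simp)
  refine ⟨QuotientAddGroup.lift (balancedRel M X) φ ?_, fun m x => rfl⟩
  rw [balancedRel, AddSubgroup.closure_le]
  rintro _ ⟨m, r, x, rfl⟩
  change φ _ = 0
  rw [map_sub]
  exact sub_eq_zero.2 (hβ m r x)

instance (X : ModuleCat.{u} R) : (tensorFunctor X).Additive where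
  map_add {M N f g} := by
    ext a
    change (tensorFunctor X).map (f + g) a = (tensorFunctor X).map f a + (tensorFunctor X).map g a
    induction a using tensor_induction with
    | h₀ => rw [map_zero, map_zero, map_zero, add_zero]
    | hm m x =>
      rw [tensorFunctor_map_mk, tensorFunctor_map_mk, tensorFunctor_map_mk, ← AddMonoidHom.add_apply,
        ← map_add]
      rfl
    | ha a b h h' => rw [map_add, map_add, map_add, h, h']; abel

variable {X : ModuleCat.{u} R} {m n : ℕ} (x : Fin n → X) (r : Fin m → Fin n → R)

/-- The morphism of free right modules that is the transpose of the matrix `r`. -/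
def transposeHom : ModuleCat.of Rᵐᵒᵖ (Fin n → Rᵐᵒᵖ) ⟶ ModuleCat.of Rᵐᵒᵖ (Fin m → Rᵐᵒᵖ) :=
  ModuleCat.ofHom (Fintype.linearCombination Rᵐᵒᵖ (fun i j => MulOpposite.op (r j i)))

/-- The element `∑ eᵢ ⊗ xᵢ`, where `eᵢ` is the standard basis. -/
def tensorGenerator : (tensorFunctor X).obj (ModuleCat.of Rᵐᵒᵖ (Fin n → Rᵐᵒᵖ)) :=
  ∑ i, tensorMk (ModuleCat.of Rᵐᵒᵖ (Fin n → Rᵐᵒᵖ)) X (Pi.single i (1 : Rᵐᵒᵖ)) (x i)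

lemma tensorFunctor_map_generator {M : ModuleCat.{u} Rᵐᵒᵖ}
    (g : ModuleCat.of Rᵐᵒᵖ (Fin n → Rᵐᵒᵖ) ⟶ M) : (tensorFunctor X).map g (tensorGenerator x) =
      ∑ i, tensorMk M X (g.hom (Pi.single i (1 : Rᵐᵒᵖ))) (x i) := by
  rw [tensorGenerator, map_sum]
  rfl

/-- A presentation of `X` by generators `x` and relations `r` induces a presentation of
`- ⊗_R X`. -/
lemma pres_tensorFunctor (hx : Function.Surjective (Fintype.linearCombination R x))
    (hr : Submodule.span R (Set.range r) = LinearMap.ker (Fintype.linearCombination R x)) :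
    Pres (tensorFunctor X) (transposeHom r) (tensorGenerator x) where
  additive := inferInstance
  -- Moving scalars across the tensor, `∑ᵢ (∑ⱼ eⱼ rⱼᵢ) ⊗ xᵢ = ∑ⱼ eⱼ ⊗ (∑ᵢ rⱼᵢ xᵢ) = 0`.
  zero := by
    have h₁ (i) : (transposeHom r).hom (Pi.single i (1 : Rᵐᵒᵖ)) =
        ∑ j, MulOpposite.op (r j i) • (Pi.single j (1 : Rᵐᵒᵖ) : Fin m → Rᵐᵒᵖ) := by
      refine (Fintype.linearCombination_apply_single (R := Rᵐᵒᵖ) _ i 1).trans ?_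
      rw [one_smul]
      exact pi_eq_sum_univ' _
    have h₂ (j) : ∑ i, r j i • x i = 0 := by
      have : r j ∈ LinearMap.ker (Fintype.linearCombination R x) :=
        hr ▸ Submodule.subset_span ⟨j, rfl⟩
      exact this
    let M := ModuleCat.of Rᵐᵒᵖ (Fin m → Rᵐᵒᵖ)
    let b (j : Fin m) : M := (Pi.single j (1 : Rᵐᵒᵖ) : Fin m → Rᵐᵒᵖ)
    have h₃ (i) : tensorMk M X ((transposeHom r).hom (Pi.single i (1 : Rᵐᵒᵖ))) (x i) =
        ∑ j, tensorMk M X (b j) (r j i • x i) := by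
      refine (congrArg (fun y => tensorMk M X y (x i)) (h₁ i)).trans ?_
      refine (congrArg (fun φ : X →+ _ => φ (x i))
        (map_sum (tensorMk M X) (fun j => MulOpposite.op (r j i) • b j) Finset.univ)).trans ?_
      rw [AddMonoidHom.finsetSum_apply]
      exact Finset.sum_congr rfl fun j _ => tensorMk_smul _ _ _
    rw [tensorFunctor_map_generator]
    refine (Finset.sum_congr rfl fun i _ => h₃ i).trans ?_
    rw [Finset.sum_comm]
    refine Finset.sum_eq_zero fun j _ => ?_
    rw [← map_sum, h₂, map_zero]
  surj M a := by
    induction a using tensor_induction with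
    | h₀ => exact ⟨0, map_zero_apply _ _⟩
    | hm m y =>
      obtain ⟨c, rfl⟩ := hx y
      -- If `y = ∑ cᵢ xᵢ`, then `m ⊗ y = ∑ (m cᵢ) ⊗ xᵢ`, the image of the generator under `eᵢ ↦ m
      -- cᵢ`.
      refine ⟨ModuleCat.ofHom (Fintype.linearCombination Rᵐᵒᵖ fun i => MulOpposite.op (c i) • m), ?_⟩
      rw [tensorFunctor_map_generator, Fintype.linearCombination_apply, map_sum]
      refine Finset.sum_congr rfl fun i _ => ?_
      rw [← tensorMk_smul]
      refine congrArg (fun z => tensorMk M X z (x i)) ?_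
      exact (Fintype.linearCombination_apply_single (R := Rᵐᵒᵖ) _ i 1).trans (one_smul _ _)
    | ha a b h h' =>
      obtain ⟨g, rfl⟩ := h
      obtain ⟨g', rfl⟩ := h'
      exact ⟨g + g', map_add_apply _ _ _ _⟩
  rel M g hg := by
    -- `ρ` is precomposition with the transpose, `Hom(R^m, M) ⟶ Hom(R^n, M)`. The aim is a map from
    -- `M ⊗ X` to its cokernel that sends `∑ bᵢ ⊗ xᵢ` to the class of `b`; then a vanishing tensor
    -- forces `b` into the range of `ρ`.
    let ρ : (Fin m → M) →+ (Fin n → M) := AddMonoidHom.mk'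
      (fun l i => ∑ j, MulOpposite.op (r j i) • l j) (fun l l' => by
        ext i
        simp [smul_add, Finset.sum_add_distrib])
    let θ (c : Fin n → R) (y : M) : (Fin n → M) ⧸ ρ.range :=
      QuotientAddGroup.mk fun i => MulOpposite.op (c i) • y
    have θ_add (c c' y) : θ (c + c') y = θ c y + θ c' y :=
      congrArg QuotientAddGroup.mk (funext fun i => add_smul (MulOpposite.op (c i)) _ y)
    have θ_add' (c y y') : θ c (y + y') = θ c y + θ c y' :=
      congrArg QuotientAddGroup.mk (funext fun i => smul_add (MulOpposite.op (c i)) y y')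
    -- A relation `c` is a combination of the rows of `r`, so `(y cᵢ)ᵢ` lies in the range of `ρ`.
    -- Hence `θ c y` depends only on the element of `X` that `c` represents.
    have θ_zero (c y) (hc : Fintype.linearCombination R x c = 0) : θ c y = 0 := by
      have : c ∈ Submodule.span R (Set.range r) := hr ▸ hc
      obtain ⟨s, rfl⟩ := (Submodule.mem_span_range_iff_exists_fun R).1 this
      refine (QuotientAddGroup.eq_zero_iff _).2 ⟨fun j => MulOpposite.op (s j) • y, ?_⟩
      ext i
      simp [ρ, Finset.sum_smul, mul_smul]
    have θ_congr (c c' y) (hc : Fintype.linearCombination R x c = Fintype.linearCombination R x c') :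
        θ c y = θ c' y := by
      have := θ_add (c - c') c' y
      rwa [sub_add_cancel, θ_zero (c - c') y (by rw [map_sub, hc, sub_self]), zero_add] at this
    choose s hs using hx
    let β : M →+ X →+ (Fin n → M) ⧸ ρ.range := AddMonoidHom.mk'
      (fun y => AddMonoidHom.mk' (fun z => θ (s z) y) fun z z' => by
        rw [← θ_add]
        exact θ_congr _ _ _ (by rw [map_add, hs, hs, hs]))
      (fun y y' => by
        ext z
        exact θ_add' _ _ _)
    obtain ⟨φ, hφ⟩ := exists_tensor_lift β fun y t z => by
      have h₁ : θ (s z) (MulOpposite.op t • y) = θ (t • s z) y :=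
        congrArg QuotientAddGroup.mk (funext fun i => smul_smul (MulOpposite.op (s z i)) _ y)
      exact h₁.trans (θ_congr _ _ _ (by rw [map_smul, hs, hs]))
    let b (i : Fin n) : M := g.hom (Pi.single i (1 : Rᵐᵒᵖ))
    have h₁ : φ ((tensorFunctor X).map g (tensorGenerator x)) = QuotientAddGroup.mk b := by
      rw [tensorFunctor_map_generator, map_sum]
      have h₂ (i) : φ (tensorMk M X (b i) (x i)) = QuotientAddGroup.mk (Pi.single i (b i)) := by
        rw [hφ]
        -- The chosen coordinates of `xᵢ` need not be `eᵢ`, but they give the same class.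
        refine (θ_congr (s (x i)) (Pi.single i 1) (b i) (by
          rw [hs, Fintype.linearCombination_apply_single, one_smul])).trans ?_
        refine congrArg QuotientAddGroup.mk (funext fun k => ?_)
        by_cases hk : k = i
        · subst hk; simp
        · simp [hk]
      refine (Finset.sum_congr rfl fun i _ => h₂ i).trans ?_
      refine (map_sum (QuotientAddGroup.mk' ρ.range) _ _).symm.trans ?_
      rw [Finset.univ_sum_single b]
      rfl
    rw [hg, map_zero] at h₁
    obtain ⟨l, hl⟩ := (QuotientAddGroup.eq_zero_iff b).1 h₁.symm
    refine ⟨ModuleCat.ofHom (Fintype.linearCombination Rᵐᵒᵖ l), ?_⟩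
    apply ModuleCat.hom_ext
    refine LinearMap.pi_ext' fun i => LinearMap.ext_ring ?_
    have h₂ : (transposeHom r).hom (Pi.single i (1 : Rᵐᵒᵖ)) = fun j => MulOpposite.op (r j i) :=
      (Fintype.linearCombination_apply_single (R := Rᵐᵒᵖ) _ i 1).trans (one_smul _ _)
    exact (congrArg (Fintype.linearCombination Rᵐᵒᵖ l) h₂).trans (congrFun hl i)

lemma exists_generators_relations (R : Type*) [Ring R] (X : Type*) [AddCommGroup X] [Module R X]
    [Module.FinitePresentation R X] : ∃ (n m : ℕ) (x : Fin n → X) (r : Fin m → Fin n → R),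
      Function.Surjective (Fintype.linearCombination R x) ∧
      Submodule.span R (Set.range r) = LinearMap.ker (Fintype.linearCombination R x) := by
  obtain ⟨n, f, hf⟩ := Module.Finite.exists_fin' R X
  have hfx : Fintype.linearCombination R (fun i => f (Pi.single i 1)) = f := by
    refine LinearMap.pi_ext' fun i => LinearMap.ext_ring ?_
    exact (Fintype.linearCombination_apply_single (R := R) _ i 1).trans (one_smul _ _)
  obtain ⟨m, r, hr⟩ := Submodule.fg_iff_exists_fin_generating_family.1
    (Module.FinitePresentation.fg_ker f hf)
  exact ⟨n, m, _, r, hfx.symm ▸ hf, by rw [hfx]; exact hr⟩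

/-- `w(- ⊗_R X) ≅ X^*`. -/
lemma nonempty_defect_tensor_iso (hx : Function.Surjective (Fintype.linearCombination R x))
    (hr : Submodule.span R (Set.range r) = LinearMap.ker (Fintype.linearCombination R x))
    (hF : isFP (tensorFunctor X)) :
    Nonempty ((defect (ModuleCat.{u} Rᵐᵒᵖ)).obj (op ⟨tensorFunctor X, hF⟩) ≅ dualModule X) := by
  let F : FP (ModuleCat.{u} Rᵐᵒᵖ) := ⟨tensorFunctor X, hF⟩
  have h : Pres F.obj (transposeHom r) (tensorGenerator x) := pres_tensorFunctor x r hx hr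
  -- Evaluation on the generators embeds `X^*` into `R^n`, where `w(- ⊗_R X)` already lies as the
  -- kernel of the transpose.
  let ε : (X →ₗ[R] R) →ₗ[Rᵐᵒᵖ] (Fin n → Rᵐᵒᵖ) :=
    { toFun := fun ψ i => MulOpposite.op (ψ (x i))
      map_add' := fun _ _ => rfl
      map_smul' := fun _ _ => rfl }
  have hε (ψ : X →ₗ[R] R) (c : Fin n → R) :
      ψ (Fintype.linearCombination R x c) = ∑ i, c i * MulOpposite.unop (ε ψ i) := by
    rw [Fintype.linearCombination_apply, map_sum]
    exact Finset.sum_congr rfl fun i _ => map_smul ψ _ _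
  have hd (a : Fin n → Rᵐᵒᵖ) (j) : (transposeHom r).hom a j =
      MulOpposite.op (∑ i, r j i * MulOpposite.unop (a i)) := by
    refine (congrFun (Fintype.linearCombination_apply (R := Rᵐᵒᵖ) _ a) j).trans ?_
    simp
  refine nonempty_iso_of_range_eq (unitElt F (tensorGenerator x)) (ModuleCat.ofHom ε)
    h.unitElt_injective ?_ fun a => ?_
  · intro ψ ψ' e
    ext y
    obtain ⟨c, rfl⟩ := hx y
    exact (hε ψ c).trans ((congrArg (fun t : Fin n → Rᵐᵒᵖ => ∑ i, c i * MulOpposite.unop (t i))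
      e).trans (hε ψ' c).symm)
  rw [h.exists_unitElt_eq_iff]
  constructor
  · intro ha
    -- A tuple killed by the transpose defines a form on `R^n` that vanishes on the relations and so
    -- descends to `X`.
    let a' : Fin n → R := fun i => MulOpposite.unop ((show Fin n → Rᵐᵒᵖ from a) i)
    let Λ := Fintype.linearCombination R a'
    have hΛ : LinearMap.ker (Fintype.linearCombination R x) ≤ LinearMap.ker Λ := by
      rw [← hr, Submodule.span_le]
      rintro _ ⟨j, rfl⟩
      exact MulOpposite.op_injective ((hd a j).symm.trans (congrFun ha j))
    refine ⟨(Submodule.liftQ _ Λ hΛ) ∘ₗ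
      (LinearMap.quotKerEquivOfSurjective _ hx).symm.toLinearMap, ?_⟩
    ext i
    refine congrArg MulOpposite.op (?_ : _ = a' i)
    have h₁ : (LinearMap.quotKerEquivOfSurjective _ hx).symm (x i) =
        Submodule.Quotient.mk (Pi.single i 1) := by
      rw [LinearEquiv.symm_apply_eq]
      exact ((Fintype.linearCombination_apply_single R x i 1).trans (one_smul _ _)).symm
    refine (congrArg (Submodule.liftQ _ Λ hΛ) h₁).trans ?_
    exact (Fintype.linearCombination_apply_single R a' i 1).trans (one_smul _ _)
  · rintro ⟨ψ, rfl⟩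
    ext j
    refine (hd (ε ψ) j).trans (congrArg MulOpposite.op ?_)
    rw [← hε]
    have : r j ∈ LinearMap.ker (Fintype.linearCombination R x) :=
      hr ▸ Submodule.subset_span ⟨j, rfl⟩
    rw [LinearMap.mem_ker.1 this, map_zero]

end TensorPresentation

end

end FunctorDefect

open FunctorDefect
theorem mainTheorem6 (R : Type u) [Ring R] (hR : IsCoherent R) :
    (∀ F : FP (ModuleCat.{u} Rᵐᵒᵖ), isTFP Rᵐᵒᵖ F.obj →
      Nonempty ((defect (ModuleCat.{u} R)).obj (op ((duality (RingEquiv.opOp R)).obj (op F))) ≅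
        (evalRing (RingEquiv.opOp R)).obj F) ∧
      Nonempty ((defect (ModuleCat.{u} Rᵐᵒᵖ)).obj (op F) ≅
        (evalRing (RingEquiv.refl Rᵐᵒᵖ)).obj ((duality (RingEquiv.opOp R)).obj (op F)))) ∧
    (∀ X : ModuleCat.{u} R, Module.FinitePresentation R X →
      ∃ h : isTFP Rᵐᵒᵖ (tensorFunctor X),
        Nonempty ((defect (ModuleCat.{u} Rᵐᵒᵖ)).obj (op ⟨tensorFunctor X, isFP_of_isTFP h⟩) ≅
          dualModule X)) := by
  refine ⟨fun F hF => ⟨nonempty_defect_duality_iso _ F,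
    nonempty_defect_iso_eval_duality_of_isTFP F hF⟩, fun X hX => ?_⟩
  obtain ⟨n, m, x, r, hx, hr⟩ := exists_generators_relations R X
  have hfree (k : ℕ) : isFinProj Rᵐᵒᵖ (ModuleCat.of Rᵐᵒᵖ (Fin k → Rᵐᵒᵖ)) :=
    ⟨inferInstanceAs (Module.Finite Rᵐᵒᵖ (Fin k → Rᵐᵒᵖ)),
      inferInstanceAs (Module.Projective Rᵐᵒᵖ (Fin k → Rᵐᵒᵖ))⟩
  exact ⟨isTFP_of_presentedBy_isFinProj ((presentedBy_iff _ _).2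
    ⟨_, _, _, _, hfree n, hfree m, pres_tensorFunctor x r hx hr⟩),
    nonempty_defect_tensor_iso x r hx hr _⟩
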